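/- A seller has a single item and $n\ge 2$ bidders whose valuations are drawn independently from a continuous probability distribution with cdf $F$ and density $f$, supported over an interval $D_F\subseteq[0,\infty)$ ($f$ is positive in the interior of $D_F$ and vanishes outside $D_F$). Assume that $F$ has monotone hazard rate (MHR), i.e. that $x\mapsto -\frac{1-F(x)}{f(x)}$ is nondecreasing on the interior of $D_F$. Let $$\mathrm{PRICE}(F,n)=\sup_{p\in D_F}p\,[1-F(p)^n]$$ be the optimal expected revenue from offering the same take-it-or-leave-it price to all bidders. Let $\mathrm{MYERSON}(F,n)$ be the supremum of the expected revenues of all (possibly randomized) direct mechanisms for selling the item that are Bayesian incentive compatible and interim individually rational, with all expected payments well defined. Put $\mathrm{APX}(F,n)=\mathrm{MYERSON}(F,n)/\mathrm{PRICE}(F,n)$. With $H_n=\sum_{i=1}^n\frac1i$ let $$g_n(c)=c\left[1-\left(1-e^{-c(H_n-1)}\right)^n\right].$$ Then, for every $n\ge2$ and every such $F$, both revenues are finite, $\mathrm{PRICE}(F,n)>0$, the maximum of $g_n$ over $[0,1]$ exists, and $$\mathrm{APX}(F,n)\le\frac{1}{\max_{c\in[0,1]}g_n(c)}+\frac{(e-1)^{n-1}}{e^n-(e-1)^n}.$$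 Moreover, uniformly over all such $F$, $$\mathrm{APX}(F,n)=1+O\!\left(\frac{\ln\ln n}{\ln n}\right)\qquad(n\to\infty),$$ i.e. there is an absolute constant $C$ such that $|\mathrm{APX}(F,n)-1|\le C\,\frac{\ln\ln n}{\ln n}$ for all sufficiently large $n$ (with a threshold not depending on $F$) and all such $F$. -/

import Mathlib

open MeasureTheory Filter
open scoped ENNReal

noncomputable section

/-- A continuous probability distribution of valuations: it has a density `pdf` and is supported
over an interval `support ⊆ [0, ∞)`.  The density is positive inside the interval; its values at
the (at most two) end points are immaterial. -/
structure ValuationDistribution where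
  support : Set ℝ
  pdf : ℝ → ℝ
  support_ordConnected : support.OrdConnected
  support_nonneg : ∀ x ∈ support, 0 ≤ x
  measurable_pdf : Measurable pdf
  pdf_nonneg : ∀ x, 0 ≤ pdf x
  pdf_pos : ∀ x ∈ interior support, 0 < pdf x
  pdf_eq_zero : ∀ x, x ∉ support → pdf x = 0
  lintegral_pdf : ∫⁻ x, ENNReal.ofReal (pdf x) = 1

namespace ValuationDistribution

/-- The law of a single valuation. -/
def law (F : ValuationDistribution) : Measure ℝ :=
  volume.withDensity fun x => ENNReal.ofReal (F.pdf x)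

instance (F : ValuationDistribution) : IsProbabilityMeasure F.law :=
  ⟨by rw [law, withDensity_apply _ MeasurableSet.univ, Measure.restrict_univ, F.lintegral_pdf]⟩

/-- The cumulative distribution function. -/
def cdf (F : ValuationDistribution) (x : ℝ) : ℝ :=
  ProbabilityTheory.cdf F.law x

/-- The `lam`-generalized virtual valuation `lam * x - (1 - F x) / f x`. -/
def virtualValuation (F : ValuationDistribution) (lam x : ℝ) : ℝ :=
  lam * x - (1 - F.cdf x) / F.pdf x

/-- `lam`-regularity: the `lam`-generalized virtual valuation is nondecreasing inside the
interval of support (where the density is positive). -/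
def IsLambdaRegular (F : ValuationDistribution) (lam : ℝ) : Prop :=
  MonotoneOn (F.virtualValuation lam) (interior F.support)

/-- Monotone hazard rate distributions: the case `lam = 0`, i.e. `-(1 - F) / f` is
nondecreasing. -/
def IsMHR (F : ValuationDistribution) : Prop :=
  F.IsLambdaRegular 0

/-- The law of the profile of `n` i.i.d. valuations. -/
def profileLaw (F : ValuationDistribution) (n : ℕ) : Measure (Fin n → ℝ) :=
  Measure.pi fun _ => F.law

/-- Expected revenue of offering the same take-it-or-leave-it price `p` to `n` bidders. -/
def pricingRevenueAt (F : ValuationDistribution) (n : ℕ) (p : ℝ) : ℝ :=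
  p * (1 - F.cdf p ^ n)

/-- The revenues attainable by anonymous pricing. -/
def pricingRevenues (F : ValuationDistribution) (n : ℕ) : Set ℝ :=
  F.pricingRevenueAt n '' F.support

/-- The optimal revenue of anonymous pricing. -/
def pricingRevenue (F : ValuationDistribution) (n : ℕ) : ℝ :=
  sSup (F.pricingRevenues n)

end ValuationDistribution

/-- A direct mechanism for selling one item to `n` bidders, possibly randomized: given the
profile `b` of reported valuations, bidder `i` receives the item with probability `alloc b i`
and makes the (expected) payment `pay b i`. -/
structure Mechanism (n : ℕ) where
  alloc : (Fin n → ℝ) → Fin n → ℝ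
  pay : (Fin n → ℝ) → Fin n → ℝ
  measurable_alloc : Measurable alloc
  measurable_pay : Measurable pay
  alloc_nonneg : ∀ b i, 0 ≤ alloc b i
  sum_alloc_le_one : ∀ b, ∑ i, alloc b i ≤ 1

namespace Mechanism

variable {n : ℕ}

/-- Expected utility of bidder `i` with true valuation `v` who reports `r`, when the other
bidders report truthfully their i.i.d. valuations from `F` (coordinate `i` of the profile `w` is
overwritten by the report). -/
def interimUtility (M : Mechanism n) (F : ValuationDistribution) (i : Fin n) (v r : ℝ) : ℝ :=
  ∫ w, (v * M.alloc (Function.update w i r) i - M.pay (Function.update w i r) i) ∂F.profileLaw n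

/-- All expected payments, unconditional and conditional on the report of the paying bidder, are
well defined. -/
def HasExpectedPayments (M : Mechanism n) (F : ValuationDistribution) : Prop :=
  ∀ i, Integrable (fun w => M.pay w i) (F.profileLaw n) ∧
    ∀ r ∈ F.support, Integrable (fun w => M.pay (Function.update w i r) i) (F.profileLaw n)

/-- Incentive compatibility: no bidder can gain in expectation by misreporting. -/
def IsTruthful (M : Mechanism n) (F : ValuationDistribution) : Prop :=
  ∀ i, ∀ v ∈ F.support, ∀ r ∈ F.support,
    M.interimUtility F i v r ≤ M.interimUtility F i v v

/-- Individual rationality: no bidder loses in expectation by participating truthfully. -/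
def IsIndividuallyRational (M : Mechanism n) (F : ValuationDistribution) : Prop :=
  ∀ i, ∀ v ∈ F.support, 0 ≤ M.interimUtility F i v v

/-- The expected revenue of the seller under truthful reports. -/
def expectedRevenue (M : Mechanism n) (F : ValuationDistribution) : ℝ :=
  ∫ v, ∑ i, M.pay v i ∂F.profileLaw n

end Mechanism

namespace ValuationDistribution

/-- The revenues attainable by truthful, individually rational mechanisms with `n` bidders. -/
def mechanismRevenues (F : ValuationDistribution) (n : ℕ) : Set ℝ :=
  {R | ∃ M : Mechanism n, M.HasExpectedPayments F ∧ M.IsTruthful F ∧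
    M.IsIndividuallyRational F ∧ M.expectedRevenue F = R}

/-- The optimal (Myerson) revenue. -/
def myersonRevenue (F : ValuationDistribution) (n : ℕ) : ℝ :=
  sSup (F.mechanismRevenues n)

/-- The approximation ratio of anonymous pricing. -/
def approxRatio (F : ValuationDistribution) (n : ℕ) : ℝ :=
  F.myersonRevenue n / F.pricingRevenue n

end ValuationDistribution

/-- The auxiliary function `g_n(c) = c [1 - (1 - exp (-c (H_n - 1)))^n]`. -/
def pricingAux (n : ℕ) (c : ℝ) : ℝ :=
  c * (1 - (1 - Real.exp (-c * ((harmonic n : ℝ) - 1))) ^ n)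

end

/-! Write S = 1 - F. Monotone hazard rate means that log S is concave on the support, so S lies
below each exponential tangent (`survival_le_exp`) and S(cx) ≥ S(x)^c for 0 ≤ c ≤ 1
(`survival_mul_ge`). The proof bounds Myerson's revenue by a quantile x plus a small correction, and
compares each of the two with the revenue of one posted price.

Upper bound on mechanisms. The envelope argument bounds expected payments by expected virtual
surplus, hence revenue by the expected positive part of the highest virtual value
(`expectedRevenue_le`). With W(s) the probability that at least two values exceed s, the derivative
of s(1 - F^n) turns this into r(1 - F(r)^n) + ∫_{s>r} W, where r is a monopoly reserve
(`integral_posVirtual_le`). The full integral ∫W is the mean of the second highest value. Let S(x) =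
exp(-(H_n - 1)). The exponential tangent at x is the survival function of a shifted exponential
whose second order statistic has mean exactly x, so ∫W ≤ x (`integral_twoTail_le`). The part below r
is at least r(1 - F(r)^(n-1)) (`le_integral_twoTail`). Subtracting, and writing q = F(r), revenue is
at most x + r(1-q)q^(n-1) (`exists_revenue_bound`).

Lower bounds on pricing. The price cx earns at least x·g_n(c), because S(cx) ≥ exp(-c(H_n - 1)). The
price r earns r(1 - q^n), and q ≤ 1 - 1/e makes the correction at most the stated fraction of it
(`one_sub_mul_pow_le`).

For the asymptotics, take c with exp(-c(H_n - 1)) = ln n / n. Posting a price is itself a truthful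
mechanism, so the ratio is at least 1. -/

noncomputable section

open Set Topology

/-! ### Distribution function, density and hazard rate -/

namespace ValuationDistribution

variable (F : ValuationDistribution)

/-- The density, normalised to vanish outside the interior of the support. -/
def density : ℝ → ℝ := (interior F.support).indicator F.pdf

/-- The hazard rate `f / (1 - F)`. -/
def hazard (x : ℝ) : ℝ := F.pdf x / (1 - F.cdf x)

lemma ordConnected_interior : (interior F.support).OrdConnected :=
  F.support_ordConnected.interior

lemma measurable_density : Measurable F.density :=
  F.measurable_pdf.indicator isOpen_interior.measurableSet

lemma density_nonneg (x : ℝ) : 0 ≤ F.density x :=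
  indicator_nonneg (fun x _ => F.pdf_nonneg x) x

/-- The frontier of an interval is null, so the unconstrained values of the density at the end
points do not matter. -/
lemma density_ae_eq : F.density =ᵐ[volume] F.pdf := by
  have hnull : volume (frontier F.support) = 0 :=
    F.support_ordConnected.convex.addHaar_frontier volume
  have hae : ∀ᵐ x, x ∉ frontier F.support := measure_eq_zero_iff_ae_notMem.1 hnull
  filter_upwards [hae] with x hx
  by_cases hxI : x ∈ interior F.support
  · simp [density, hxI]
  · have : x ∉ F.support := fun h => hx ⟨subset_closure h, hxI⟩
    simp [density, hxI, F.pdf_eq_zero x this]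

lemma law_eq_withDensity :
    F.law = volume.withDensity fun x => ENNReal.ofReal (F.density x) := by
  refine withDensity_congr_ae ?_
  filter_upwards [F.density_ae_eq] with x hx
  rw [hx]

lemma lintegral_density : ∫⁻ x, ENNReal.ofReal (F.density x) = 1 := by
  rw [← F.lintegral_pdf]
  refine lintegral_congr_ae ?_
  filter_upwards [F.density_ae_eq] with x hx
  rw [hx]

lemma integrable_density : Integrable F.density := by
  refine ⟨F.measurable_density.aestronglyMeasurable, ?_⟩
  rw [hasFiniteIntegral_iff_ofReal (Eventually.of_forall F.density_nonneg), F.lintegral_density]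
  exact ENNReal.one_lt_top

instance : NullSingletonClass F.law :=
  ⟨fun x => by
    rw [law]
    exact withDensity_absolutelyContinuous _ _ (measure_singleton x)⟩

lemma cdf_eq_integral (x : ℝ) : F.cdf x = ∫ t in Iic x, F.density t := by
  rw [cdf, ProbabilityTheory.cdf_eq_real, law_eq_withDensity, measureReal_def,
    withDensity_apply _ measurableSet_Iic,
    integral_eq_lintegral_of_nonneg_ae (Eventually.of_forall F.density_nonneg)
      F.measurable_density.aestronglyMeasurable.restrict]

lemma cdf_sub (x y : ℝ) : F.cdf y - F.cdf x = ∫ t in x..y, F.density t := by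
  rw [cdf_eq_integral, cdf_eq_integral]
  exact intervalIntegral.integral_Iic_sub_Iic F.integrable_density.integrableOn
    F.integrable_density.integrableOn

lemma continuous_cdf : Continuous F.cdf := by
  have h : F.cdf = fun y => F.cdf 0 + ∫ t in (0 : ℝ)..y, F.density t := by
    ext y
    rw [← F.cdf_sub]
    ring
  rw [h]
  exact continuous_const.add (intervalIntegral.continuous_primitive
    (fun a b => F.integrable_density.intervalIntegrable) 0)

lemma monotone_cdf : Monotone F.cdf := ProbabilityTheory.monotone_cdf _

lemma cdf_nonneg (x : ℝ) : 0 ≤ F.cdf x := ProbabilityTheory.cdf_nonneg _ x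

lemma cdf_le_one (x : ℝ) : F.cdf x ≤ 1 := ProbabilityTheory.cdf_le_one _ x

lemma nonempty_interior : (interior F.support).Nonempty := by
  rw [nonempty_iff_ne_empty]
  intro h
  have := F.lintegral_density
  simp [density, h] at this

lemma nonneg_of_mem_interior {x : ℝ} (hx : x ∈ interior F.support) : 0 ≤ x :=
  F.support_nonneg x (interior_subset hx)

lemma pos_of_mem_interior {x : ℝ} (hx : x ∈ interior F.support) : 0 < x := by
  have h : interior F.support ⊆ interior (Ici 0) := interior_mono F.support_nonneg
  rw [interior_Ici] at h
  exact h hx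

lemma cdf_eq_zero_of_lt {x y : ℝ} (hx : x ∉ interior F.support) (hy : y ∈ interior F.support)
    (hxy : x < y) : F.cdf x = 0 := by
  rw [cdf_eq_integral]
  refine setIntegral_eq_zero_of_forall_eq_zero fun t ht => ?_
  refine indicator_of_notMem (fun htI => hx ?_) _
  exact F.ordConnected_interior.out htI hy ⟨ht, hxy.le⟩

lemma cdf_eq_one_of_lt {x y : ℝ} (hx : x ∉ interior F.support) (hy : y ∈ interior F.support)
    (hxy : y < x) : F.cdf x = 1 := by
  have h1 : ∫ t, F.density t = 1 := by
    rw [integral_eq_lintegral_of_nonneg_ae (Eventually.of_forall F.density_nonneg)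
      F.measurable_density.aestronglyMeasurable, F.lintegral_density, ENNReal.toReal_one]
  rw [cdf_eq_integral, ← h1]
  refine setIntegral_eq_integral_of_forall_compl_eq_zero fun t ht => ?_
  refine indicator_of_notMem (fun htI => hx ?_) _
  exact F.ordConnected_interior.out hy htI ⟨hxy.le, (not_le.1 ht).le⟩

lemma cdf_eq_zero_or_one {x : ℝ} (hx : x ∉ interior F.support) :
    F.cdf x = 0 ∨ F.cdf x = 1 := by
  obtain ⟨y, hy⟩ := F.nonempty_interior
  rcases lt_trichotomy x y with h | h | h
  · exact Or.inl (F.cdf_eq_zero_of_lt hx hy h)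
  · exact absurd (h ▸ hy) hx
  · exact Or.inr (F.cdf_eq_one_of_lt hx hy h)

lemma cdf_lt_cdf {x y : ℝ} (hx : x ∈ interior F.support) (hxy : x < y) :
    F.cdf x < F.cdf y := by
  obtain ⟨z, hz, hxz⟩ : ∃ z, z ∈ Ioc x y ∧ Icc x z ⊆ interior F.support := by
    obtain ⟨u, hu, hsub⟩ := exists_Ico_subset_of_mem_nhds (isOpen_interior.mem_nhds hx) ⟨y, hxy⟩
    obtain ⟨z, hz1, hz2⟩ := exists_between (lt_min hu hxy)
    exact ⟨z, ⟨hz1, (hz2.trans_le (min_le_right _ _)).le⟩, fun t ht => hsub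
      ⟨ht.1, ht.2.trans_lt (hz2.trans_le (min_le_left _ _))⟩⟩
  refine lt_of_lt_of_le ?_ (F.monotone_cdf hz.2)
  rw [← sub_pos, F.cdf_sub]
  refine intervalIntegral.intervalIntegral_pos_of_pos_on
    F.integrable_density.intervalIntegrable (fun t ht => ?_) hz.1
  have htI := hxz ⟨ht.1.le, ht.2.le⟩
  rw [density, indicator_of_mem htI]
  exact F.pdf_pos t htI

lemma cdf_lt_one {x : ℝ} (hx : x ∈ interior F.support) : F.cdf x < 1 :=
  (F.cdf_lt_cdf hx (lt_add_one x)).trans_le (F.cdf_le_one _)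

lemma cdf_pos {x : ℝ} (hx : x ∈ interior F.support) : 0 < F.cdf x := by
  obtain ⟨l, hl, hsub⟩ := exists_Ioc_subset_of_mem_nhds (isOpen_interior.mem_nhds hx)
    ⟨x - 1, sub_one_lt x⟩
  obtain ⟨z, hz1, hz2⟩ := exists_between hl
  exact (F.cdf_nonneg z).trans_lt (F.cdf_lt_cdf (hsub ⟨hz1, hz2.le⟩) hz2)

lemma cdf_of_nonpos {x : ℝ} (hx : x ≤ 0) : F.cdf x = 0 := by
  obtain ⟨y, hy⟩ := F.nonempty_interior
  exact F.cdf_eq_zero_of_lt (fun h => hx.not_gt (F.pos_of_mem_interior h)) hy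
    (hx.trans_lt (F.pos_of_mem_interior hy))

lemma bddBelow_interior : BddBelow (interior F.support) :=
  ⟨0, fun _ hx => F.nonneg_of_mem_interior hx⟩

lemma sInf_interior_nonneg : 0 ≤ sInf (interior F.support) :=
  Real.sInf_nonneg fun _ hx => F.nonneg_of_mem_interior hx

lemma sInf_notMem_interior : sInf (interior F.support) ∉ interior F.support := by
  intro h
  obtain ⟨l, hl, hsub⟩ := exists_Ioc_subset_of_mem_nhds (isOpen_interior.mem_nhds h)
    ⟨_, sub_one_lt _⟩
  obtain ⟨z, hz1, hz2⟩ := exists_between hl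
  exact hz2.not_ge (csInf_le F.bddBelow_interior (hsub ⟨hz1, hz2.le⟩))

lemma cdf_eq_zero_of_le_sInf {x : ℝ} (hx : x ≤ sInf (interior F.support)) : F.cdf x = 0 := by
  obtain ⟨y, hy⟩ := F.nonempty_interior
  have h : sInf (interior F.support) < y :=
    lt_of_le_of_ne (csInf_le F.bddBelow_interior hy) fun h => F.sInf_notMem_interior (h ▸ hy)
  exact le_antisymm ((F.monotone_cdf hx).trans_eq
    (F.cdf_eq_zero_of_lt F.sInf_notMem_interior hy h)) (F.cdf_nonneg x)

lemma mem_interior_of_cdf {x : ℝ} (h0 : 0 < F.cdf x) (h1 : F.cdf x < 1) :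
    x ∈ interior F.support := by
  by_contra h
  rcases F.cdf_eq_zero_or_one h with h | h <;> linarith

lemma exists_cdf_eq {u : ℝ} (h0 : 0 < u) (h1 : u < 1) :
    ∃ x ∈ interior F.support, F.cdf x = u := by
  obtain ⟨x, hx⟩ := mem_range_of_exists_le_of_exists_ge F.continuous_cdf
    ((ProbabilityTheory.tendsto_cdf_atBot F.law).eventually_le_const h0).exists
    ((ProbabilityTheory.tendsto_cdf_atTop F.law).eventually_const_le h1).exists
  exact ⟨x, F.mem_interior_of_cdf (hx ▸ h0) (hx ▸ h1), hx⟩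

lemma hazard_pos {x : ℝ} (hx : x ∈ interior F.support) : 0 < F.hazard x :=
  div_pos (F.pdf_pos x hx) (sub_pos.2 (F.cdf_lt_one hx))

lemma pdf_eq_hazard_mul {x : ℝ} (hx : x ∈ interior F.support) :
    F.pdf x = F.hazard x * (1 - F.cdf x) := by
  rw [hazard, div_mul_cancel₀ _ (sub_pos.2 (F.cdf_lt_one hx)).ne']

variable {F}

lemma IsMHR.monotoneOn_hazard (hF : F.IsMHR) : MonotoneOn F.hazard (interior F.support) := by
  intro x hx y hy hxy
  have h := hF hx hy hxy
  have hfx := F.pdf_pos x hx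
  have hfy := F.pdf_pos y hy
  have hSx := sub_pos.2 (F.cdf_lt_one hx)
  have hSy := sub_pos.2 (F.cdf_lt_one hy)
  simp only [virtualValuation, zero_mul, zero_sub, neg_le_neg_iff] at h
  rw [div_le_div_iff₀ hfy hfx] at h
  rw [hazard, hazard, div_le_div_iff₀ hSx hSy]
  linarith

/-- Off a countable set the cdf is differentiable, with derivative the density. -/
lemma IsMHR.exists_countable_hasDerivAt (hF : F.IsMHR) :
    ∃ C : Set ℝ, C.Countable ∧ ∀ x ∉ C, HasDerivAt F.cdf (F.density x) x := by
  set I := interior F.support with hI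
  -- A monotone hazard rate has countably many discontinuities; the end points are added. If the
  -- support is unbounded, `sSup I` is the default 0, and one extra exceptional point is harmless.
  refine ⟨{x ∈ I | ¬ ContinuousWithinAt F.hazard I x} ∪ {sInf I, sSup I},
    hF.monotoneOn_hazard.countable_not_continuousWithinAt.union (Set.toFinite _).countable,
    fun x hx => ?_⟩
  simp only [mem_union, mem_ofPred_eq, not_or, not_and, not_not, mem_insert_iff,
    mem_singleton_iff] at hx
  obtain ⟨hc, hinf, hsup⟩ := hx
  obtain ⟨y, hy⟩ := F.nonempty_interior
  by_cases hxI : x ∈ I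
  · have hcont : ContinuousAt F.density x := by
      have h1 : ContinuousAt (fun t => F.hazard t * (1 - F.cdf t)) x :=
        ((hc hxI).continuousAt (isOpen_interior.mem_nhds hxI)).mul
          (continuous_const.sub F.continuous_cdf).continuousAt
      refine h1.congr ?_
      filter_upwards [isOpen_interior.mem_nhds hxI] with t ht
      rw [density, indicator_of_mem ht, F.pdf_eq_hazard_mul ht]
    have h := intervalIntegral.integral_hasDerivAt_right
      (F.integrable_density.intervalIntegrable (a := 0) (b := x))
      (F.measurable_density.stronglyMeasurable.stronglyMeasurableAtFilter) hcont
    refine (h.const_add (F.cdf 0)).congr_of_eventuallyEq (Eventually.of_forall fun t => ?_)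
    simp only [← F.cdf_sub, add_sub_cancel]
  · rw [density, indicator_of_notMem hxI]
    rcases lt_trichotomy x y with h | h | h
    · have hlt : x < sInf I := by
        refine lt_of_le_of_ne (le_csInf ⟨y, hy⟩ fun z hz => ?_) hinf
        by_contra! hzx
        exact hxI (F.ordConnected_interior.out hz hy ⟨hzx.le, h.le⟩)
      refine (hasDerivAt_const x (0 : ℝ)).congr_of_eventuallyEq ?_
      filter_upwards [Iio_mem_nhds hlt] with t ht
      exact F.cdf_eq_zero_of_le_sInf (le_of_lt ht)
    · exact absurd (h ▸ hy) hxI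
    · have hle : ∀ z ∈ I, z ≤ x := fun z hz => by
        by_contra! hzx
        exact hxI (F.ordConnected_interior.out hy hz ⟨h.le, hzx.le⟩)
      have hlt : sSup I < x := lt_of_le_of_ne (csSup_le ⟨y, hy⟩ hle) (Ne.symm hsup)
      refine (hasDerivAt_const x (1 : ℝ)).congr_of_eventuallyEq ?_
      filter_upwards [Ioi_mem_nhds hlt] with t ht
      refine F.cdf_eq_one_of_lt (fun htI => ?_) hy ?_
      · exact (not_le.2 ht) (le_csSup ⟨x, hle⟩ htI)
      · exact (le_csSup ⟨x, hle⟩ hy).trans_lt ht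

end ValuationDistribution

/-! ### Log-concavity of the survival function, reserve price, finite mean -/

namespace ValuationDistribution

variable {F : ValuationDistribution}

/-- The logarithm of the survival function lies below its tangents inside the support. -/
lemma IsMHR.log_le_tangent (hF : F.IsMHR) {x y : ℝ} (hx : x ∈ interior F.support)
    (hy : y ∈ interior F.support) :
    Real.log (1 - F.cdf x) ≤ Real.log (1 - F.cdf y) - F.hazard y * (x - y) := by
  obtain ⟨C, hC, hderiv⟩ := hF.exists_countable_hasDerivAt
  have hsub : uIcc y x ⊆ interior F.support := F.ordConnected_interior.uIcc_subset hy hx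
  have hint : IntervalIntegrable F.hazard volume y x :=
    (hF.monotoneOn_hazard.mono hsub).intervalIntegrable
  -- The derivative of log(1 - F) is minus the hazard rate; monotonicity then compares its integral
  -- with the constant hazard at y, in either orientation.
  have key := MeasureTheory.integral_eq_of_hasDerivAt_off_countable
    (fun t => Real.log (1 - F.cdf t)) (fun t => -F.hazard t) (a := y) (b := x) hC
    (ContinuousOn.log (continuous_const.sub F.continuous_cdf).continuousOn
      fun t ht => (sub_pos.2 (F.cdf_lt_one (hsub ht))).ne')
    (fun t ht => by
      have htI : t ∈ interior F.support := hsub (Ioo_subset_Icc_self ht.1)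
      have h := ((hderiv t ht.2).const_sub 1).log (sub_pos.2 (F.cdf_lt_one htI)).ne'
      rwa [density, indicator_of_mem htI, neg_div] at h)
    hint.neg
  rw [intervalIntegral.integral_neg] at key
  have hc : ∫ _ in y..x, F.hazard y = F.hazard y * (x - y) := by
    rw [intervalIntegral.integral_const, smul_eq_mul, mul_comm]
  rcases le_total y x with h | h
  · have : ∫ _ in y..x, F.hazard y ≤ ∫ t in y..x, F.hazard t :=
      intervalIntegral.integral_mono_on h intervalIntegrable_const hint fun t ht =>
        hF.monotoneOn_hazard hy (hsub (uIcc_of_le h ▸ ht)) ht.1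
    linarith
  · have : ∫ t in x..y, F.hazard t ≤ ∫ _ in x..y, F.hazard y :=
      intervalIntegral.integral_mono_on h hint.symm intervalIntegrable_const fun t ht =>
        hF.monotoneOn_hazard (hsub (uIcc_of_ge h ▸ ht)) hy ht.2
    rw [intervalIntegral.integral_symm y x, intervalIntegral.integral_symm y x] at this
    linarith

/-- The survival function is dominated by its exponential tangents. -/
lemma IsMHR.survival_le_exp (hF : F.IsMHR) {y : ℝ} (hy : y ∈ interior F.support) (x : ℝ) :
    1 - F.cdf x ≤ (1 - F.cdf y) * Real.exp (-(F.hazard y * (x - y))) := by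
  have hSy := sub_pos.2 (F.cdf_lt_one hy)
  have hI : ∀ z ∈ interior F.support,
      1 - F.cdf z ≤ (1 - F.cdf y) * Real.exp (-(F.hazard y * (z - y))) := fun z hz => by
    have hSz := sub_pos.2 (F.cdf_lt_one hz)
    have h := Real.exp_le_exp.2 (hF.log_le_tangent hz hy)
    rwa [Real.exp_log hSz, sub_eq_add_neg (Real.log _), Real.exp_add, Real.exp_log hSy] at h
  by_cases hx : x ∈ interior F.support
  · exact hI x hx
  · rcases F.cdf_eq_zero_or_one hx with h0 | h1
    · have hxy : x < y := by
        by_contra! h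
        have := F.monotone_cdf h
        linarith [F.cdf_pos hy]
      set a := sInf (interior F.support) with ha
      have hle : x ≤ a := by
        refine le_csInf ⟨y, hy⟩ fun z hz => ?_
        by_contra! hzx
        exact hx (F.ordConnected_interior.out hz hy ⟨hzx.le, hxy.le⟩)
      -- The bound passes to the left end point a by continuity; further left the survival function
      -- stays 1 while the exponential grows.
      have hcl : IsClosed {z | 1 - F.cdf z ≤ (1 - F.cdf y) * Real.exp (-(F.hazard y * (z - y)))} :=
        isClosed_le (continuous_const.sub F.continuous_cdf) (by fun_prop)
      have hmem := closure_minimal hI hcl (csInf_mem_closure ⟨y, hy⟩ F.bddBelow_interior)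
      have hmem' : 1 - F.cdf a ≤ (1 - F.cdf y) * Real.exp (-(F.hazard y * (a - y))) := hmem
      rw [F.cdf_eq_zero_of_le_sInf le_rfl] at hmem'
      rw [h0]
      refine hmem'.trans ?_
      gcongr
      exact (F.hazard_pos hy).le
    · rw [h1, sub_self]
      positivity

/-- This is the exponential tangent at y read off at the origin, where the survival function is 1.
-/
lemma IsMHR.neg_log_survival_le (hF : F.IsMHR) {y : ℝ} (hy : y ∈ interior F.support) :
    -Real.log (1 - F.cdf y) ≤ y * F.hazard y := by
  have hSy := sub_pos.2 (F.cdf_lt_one hy)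
  have h := hF.survival_le_exp hy 0
  rw [F.cdf_of_nonpos le_rfl, sub_zero] at h
  have h2 := Real.log_le_log one_pos h
  rw [Real.log_one, Real.log_mul hSy.ne' (Real.exp_pos _).ne', Real.log_exp] at h2
  linarith

/-- Log-concavity of the survival function along the segment from the origin. -/
lemma IsMHR.survival_mul_ge (hF : F.IsMHR) {x c : ℝ} (hx : F.cdf x < 1)
    (hc0 : 0 ≤ c) (hc1 : c ≤ 1) :
    Real.exp (c * Real.log (1 - F.cdf x)) ≤ 1 - F.cdf (c * x) := by
  have hle1 : ∀ z, Real.log (1 - F.cdf z) ≤ 0 := fun z =>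
    Real.log_nonpos (by linarith [F.cdf_le_one z]) (by linarith [F.cdf_nonneg z])
  rcases eq_or_lt_of_le (F.cdf_nonneg (c * x)) with h0 | hpos
  · rw [← h0, sub_zero, Real.exp_le_one_iff]
    exact mul_nonpos_of_nonneg_of_nonpos hc0 (hle1 x)
  have hcpos : 0 < c := by
    rcases eq_or_lt_of_le hc0 with h | h
    · rw [← h, zero_mul, F.cdf_of_nonpos le_rfl] at hpos
      exact absurd hpos (lt_irrefl _)
    · exact h
  have hxpos : 0 < x := by
    by_contra! h
    rw [F.cdf_of_nonpos (mul_nonpos_of_nonneg_of_nonpos hc0 h)] at hpos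
    exact lt_irrefl _ hpos
  have hcx : c * x ≤ x := by nlinarith
  have hlt : F.cdf (c * x) < 1 := (F.monotone_cdf hcx).trans_lt hx
  have hmem := F.mem_interior_of_cdf hpos hlt
  have hxmem := F.mem_interior_of_cdf (hpos.trans_le (F.monotone_cdf hcx)) hx
  have h1 := hF.log_le_tangent hxmem hmem
  have h2 := hF.neg_log_survival_le hmem
  rw [← Real.le_log_iff_exp_le (sub_pos.2 hlt)]
  -- The tangent at c·x is evaluated at x with weight c and at 0 with weight 1 - c; the slope terms
  -- cancel.
  have h3 : c * Real.log (1 - F.cdf x) ≤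
      c * (Real.log (1 - F.cdf (c * x)) - F.hazard (c * x) * (x - c * x)) :=
    mul_le_mul_of_nonneg_left h1 hc0
  nlinarith [mul_le_mul_of_nonneg_left h2 (sub_nonneg.2 hc1)]

/-- A monopoly reserve price. -/
lemma IsMHR.exists_reserve (hF : F.IsMHR) :
    ∃ r : ℝ, 0 ≤ r ∧ F.cdf r ≤ 1 - Real.exp (-1) ∧
      (∀ s ∈ interior F.support, s < r → s * F.hazard s ≤ 1) ∧
      (∀ s ∈ interior F.support, r < s → 1 < s * F.hazard s) := by
  set I := interior F.support with hI
  -- The reserve is `sSup A`. Inserting the left end point covers the case where s·hazard exceeds 1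
  -- on the whole support.
  set A := insert (sInf I) {s ∈ I | s * F.hazard s ≤ 1} with hA
  have hmono : ∀ s ∈ I, ∀ t ∈ I, s ≤ t → s * F.hazard s ≤ t * F.hazard t := fun s hs t ht hst =>
    mul_le_mul hst (hF.monotoneOn_hazard hs ht hst) (F.hazard_pos hs).le
      (F.nonneg_of_mem_interior ht)
  have hAcdf : ∀ s ∈ A, F.cdf s ≤ 1 - Real.exp (-1) := by
    rintro s (rfl | ⟨hs, hs1⟩)
    · rw [F.cdf_eq_zero_of_le_sInf le_rfl]
      exact sub_nonneg.2 (Real.exp_le_one_iff.2 (by norm_num))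
    · have h1 := hF.neg_log_survival_le hs
      have h2 : -1 ≤ Real.log (1 - F.cdf s) := by linarith
      rw [Real.le_log_iff_exp_le (sub_pos.2 (F.cdf_lt_one hs))] at h2
      linarith
  have hne : A.Nonempty := ⟨_, mem_insert _ _⟩
  have hbdd : BddAbove A := by
    -- Any quantile level strictly between 1 - 1/e and 1 would bound A.
    obtain ⟨x, -, hx⟩ := F.exists_cdf_eq (u := 1 - Real.exp (-2))
      (sub_pos.2 (Real.exp_lt_one_iff.2 (by norm_num))) (by linarith [Real.exp_pos (-2)])
    refine ⟨x, fun s hs => ?_⟩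
    by_contra! h
    have h1 := (F.monotone_cdf h.le).trans (hAcdf s hs)
    have h2 : Real.exp (-2) < Real.exp (-1) := Real.exp_lt_exp.2 (by norm_num)
    linarith
  refine ⟨sSup A, F.sInf_interior_nonneg.trans (le_csSup hbdd (mem_insert _ _)), ?_, ?_, ?_⟩
  · exact closure_minimal hAcdf (isClosed_le F.continuous_cdf continuous_const)
      (csSup_mem_closure hne hbdd)
  · intro s hs hlt
    obtain ⟨t, ht, hst⟩ := exists_lt_of_lt_csSup hne hlt
    rcases ht with rfl | ht
    · exact absurd (csInf_le F.bddBelow_interior hs) hst.not_ge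
    · exact (hmono s hs t ht.1 hst.le).trans ht.2
  · intro s hs hlt
    by_contra! h
    exact hlt.not_ge (le_csSup hbdd (Or.inr ⟨hs, h⟩))

/-- Exponential tails: the expected valuation is finite. -/
lemma IsMHR.integrableOn_survival (hF : F.IsMHR) :
    IntegrableOn (fun s => 1 - F.cdf s) (Ioi 0) := by
  obtain ⟨y, hy⟩ := F.nonempty_interior
  have h : IntegrableOn (fun s => (1 - F.cdf y) * Real.exp (F.hazard y * y) *
      Real.exp (-F.hazard y * s)) (Ioi 0) :=
    (integrableOn_exp_mul_Ioi (neg_lt_zero.2 (F.hazard_pos hy)) 0).const_mul _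
  refine Integrable.mono' h
    (continuous_const.sub F.continuous_cdf).aestronglyMeasurable.restrict
    (Eventually.of_forall fun s => ?_)
  rw [Real.norm_of_nonneg (sub_nonneg.2 (F.cdf_le_one s)), mul_assoc, ← Real.exp_add]
  refine (hF.survival_le_exp hy s).trans_eq ?_
  ring_nf

lemma law_Ioi (x : ℝ) : F.law (Ioi x) = ENNReal.ofReal (1 - F.cdf x) := by
  rw [← compl_Iic, prob_compl_eq_one_sub measurableSet_Iic, ENNReal.ofReal_sub _ (F.cdf_nonneg x),
    ENNReal.ofReal_one, cdf, ProbabilityTheory.ofReal_cdf F.law x]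

lemma law_real_Iic (x : ℝ) : F.law.real (Iic x) = F.cdf x := by
  rw [cdf, ProbabilityTheory.cdf_eq_real]

lemma ae_mem_interior : ∀ᵐ x ∂F.law, x ∈ interior F.support := by
  rw [law_eq_withDensity, ae_withDensity_iff F.measurable_density.ennreal_ofReal]
  refine Eventually.of_forall fun x hx => ?_
  by_contra h
  exact hx (by simp [density, h])

lemma IsMHR.integrable_id (hF : F.IsMHR) : Integrable (fun x : ℝ => x) F.law := by
  have hnn : 0 ≤ᵐ[F.law] fun x : ℝ => x :=
    F.ae_mem_interior.mono fun x hx => F.nonneg_of_mem_interior hx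
  refine ⟨aestronglyMeasurable_id, ?_⟩
  rw [hasFiniteIntegral_iff_ofReal hnn, lintegral_eq_lintegral_meas_lt F.law hnn aemeasurable_id']
  have h := hF.integrableOn_survival.2
  rw [hasFiniteIntegral_iff_ofReal
    (Eventually.of_forall fun s => sub_nonneg.2 (F.cdf_le_one s))] at h
  refine lt_of_eq_of_lt (lintegral_congr fun t => ?_) h
  rw [← law_Ioi]
  rfl

end ValuationDistribution

/-! ### Subgradients, virtual valuations and information rents -/

/-- A function with a bounded measurable subgradient on an open interval grows at least as fast
as the integral of that subgradient. -/
lemma intervalIntegral_le_sub_of_subgradient {I : Set ℝ} (hIo : IsOpen I) (hIc : I.OrdConnected)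
    {u x : ℝ → ℝ} (hx : Measurable x) {B : ℝ} (hB : ∀ t, ‖x t‖ ≤ B)
    (hux : ∀ s ∈ I, ∀ t ∈ I, (t - s) * x s ≤ u t - u s) {a b : ℝ} (ha : a ∈ I) (hb : b ∈ I)
    (hab : a ≤ b) : ∫ t in a..b, x t ≤ u b - u a := by
  -- A function with a subgradient at every point is convex, so its right derivative exists; it
  -- dominates the subgradient.
  have hconv : ConvexOn ℝ I u := by
    refine ⟨hIc.convex, fun s hs t ht α β hα hβ hαβ => ?_⟩
    have hz : α • s + β • t ∈ I := hIc.convex hs ht hα hβ hαβ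
    simp only [smul_eq_mul] at hz ⊢
    have h1 := mul_le_mul_of_nonneg_left (hux _ hz s hs) hα
    have h2 := mul_le_mul_of_nonneg_left (hux _ hz t ht) hβ
    have h3 : β = 1 - α := by linarith
    subst h3
    nlinarith
  have hsub : Icc a b ⊆ I := hIc.out ha hb
  refine intervalIntegral.integral_le_sub_of_hasDeriv_right_of_le hab
    ((hconv.continuousOn hIo).mono hsub) (g' := fun t => derivWithin u (Ioi t) t)
    (fun t ht => hconv.hasDerivWithinAt_rightDeriv_of_mem_interior
      (hIo.interior_eq.symm ▸ hsub (Ioo_subset_Icc_self ht)))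
    (Measure.integrableOn_of_bounded (M := B) measure_Icc_lt_top.ne hx.aestronglyMeasurable
      (Eventually.of_forall hB)) fun t ht => ?_
  have htI := hsub (Ioo_subset_Icc_self ht)
  have hd := hconv.hasDerivWithinAt_rightDeriv_of_mem_interior (hIo.interior_eq.symm ▸ htI)
  rw [hasDerivWithinAt_iff_tendsto_slope' (notMem_Ioi.2 le_rfl)] at hd
  refine ge_of_tendsto hd ?_
  filter_upwards [Ioo_mem_nhdsGT ht.2] with z hz
  have h1 := hux t htI z (hsub ⟨ht.1.le.trans hz.1.le, hz.2.le⟩)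
  rw [slope_def_field, le_div_iff₀ (sub_pos.2 hz.1)]
  linarith

namespace ValuationDistribution

variable {F : ValuationDistribution}

lemma measurable_virtualValuation (F : ValuationDistribution) (lam : ℝ) :
    Measurable (F.virtualValuation lam) :=
  (measurable_const.mul measurable_id).sub
    ((measurable_const.sub F.continuous_cdf.measurable).div F.measurable_pdf)

/-- The positive part of the virtual valuation. -/
def posVirtual (F : ValuationDistribution) (x : ℝ) : ℝ := max (F.virtualValuation 1 x) 0

lemma measurable_posVirtual (F : ValuationDistribution) : Measurable F.posVirtual :=
  (F.measurable_virtualValuation 1).max measurable_const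

lemma posVirtual_nonneg (F : ValuationDistribution) (x : ℝ) : 0 ≤ F.posVirtual x :=
  le_max_right _ _

lemma posVirtual_le {x : ℝ} (hx : 0 ≤ x) : F.posVirtual x ≤ x := by
  refine max_le ?_ hx
  rw [virtualValuation, one_mul]
  exact sub_le_self _ (div_nonneg (sub_nonneg.2 (F.cdf_le_one x)) (F.pdf_nonneg x))

/-- The virtual valuation is the nondecreasing -(1 - F)/f plus the identity: MHR implies regularity.
-/
lemma IsMHR.monotoneOn_posVirtual (hF : F.IsMHR) :
    MonotoneOn F.posVirtual (interior F.support) := by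
  intro x hx y hy hxy
  have h := hF hx hy hxy
  simp only [virtualValuation] at h
  refine max_le_max ?_ le_rfl
  simp only [virtualValuation]
  linarith

lemma IsMHR.integrable_posVirtual (hF : F.IsMHR) : Integrable F.posVirtual F.law := by
  refine hF.integrable_id.mono' F.measurable_posVirtual.aestronglyMeasurable ?_
  filter_upwards [F.ae_mem_interior] with x hx
  rw [Real.norm_of_nonneg (F.posVirtual_nonneg x)]
  exact posVirtual_le (F.nonneg_of_mem_interior hx)

section InformationRent

variable {x : ℝ → ℝ}

lemma intervalIntegrable_indicator (hx : Measurable x) (h0 : ∀ t, 0 ≤ x t) (h1 : ∀ t, x t ≤ 1)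
    (a b : ℝ) : IntervalIntegrable ((interior F.support).indicator x) volume a b := by
  refine (intervalIntegrable_const (c := (1 : ℝ))).mono_fun
    (hx.indicator isOpen_interior.measurableSet).aestronglyMeasurable
    (Eventually.of_forall fun t => ?_)
  rw [norm_one]
  refine (norm_indicator_le_norm_self _ _).trans ?_
  rw [Real.norm_of_nonneg (h0 t)]
  exact h1 t

lemma rent_nonneg (h0 : ∀ t, 0 ≤ x t) {s : ℝ} (hs : 0 ≤ s) :
    0 ≤ ∫ t in (0 : ℝ)..s, (interior F.support).indicator x t :=
  intervalIntegral.integral_nonneg hs fun t _ => indicator_nonneg (fun t _ => h0 t) t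

lemma rent_le (hx : Measurable x) (h0 : ∀ t, 0 ≤ x t) (h1 : ∀ t, x t ≤ 1) {s : ℝ} (hs : 0 ≤ s) :
    ∫ t in (0 : ℝ)..s, (interior F.support).indicator x t ≤ s := by
  have h : ∫ t in (0 : ℝ)..s, (interior F.support).indicator x t ≤ ∫ _ in (0 : ℝ)..s, (1 : ℝ) :=
    intervalIntegral.integral_mono_on hs (intervalIntegrable_indicator hx h0 h1 _ _)
      intervalIntegrable_const fun t _ =>
        indicator_le' (fun t _ => h1 t) (fun _ _ => zero_le_one) t
  simpa using h

lemma IsMHR.integrable_rent (hF : F.IsMHR) (hx : Measurable x) (h0 : ∀ t, 0 ≤ x t)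
    (h1 : ∀ t, x t ≤ 1) :
    Integrable (fun s => ∫ t in (0 : ℝ)..s, (interior F.support).indicator x t) F.law := by
  refine hF.integrable_id.mono' ?_ ?_
  · exact (intervalIntegral.continuous_primitive
      (fun a b => intervalIntegrable_indicator hx h0 h1 a b) 0).aestronglyMeasurable
  · filter_upwards [F.ae_mem_interior] with s hs
    have := F.nonneg_of_mem_interior hs
    rw [Real.norm_of_nonneg (rent_nonneg h0 this)]
    exact rent_le hx h0 h1 this

/-- By the layer-cake formula (Tonelli) both sides are the integral of x(t)(1 - F(t)) over the
support. -/
lemma lintegral_rent (hx : Measurable x) (h0 : ∀ t, 0 ≤ x t) (h1 : ∀ t, x t ≤ 1) :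
    ∫⁻ s, ENNReal.ofReal (∫ t in (0 : ℝ)..s, (interior F.support).indicator x t) ∂F.law =
      ∫⁻ s, ENNReal.ofReal (x s * ((1 - F.cdf s) / F.pdf s)) ∂F.law := by
  have hnn : 0 ≤ᵐ[F.law] fun x : ℝ => x :=
    F.ae_mem_interior.mono fun x hx => F.nonneg_of_mem_interior hx
  have hmeas : Measurable fun s => ENNReal.ofReal (x s * ((1 - F.cdf s) / F.pdf s)) :=
    (hx.mul ((measurable_const.sub F.continuous_cdf.measurable).div
      F.measurable_pdf)).ennreal_ofReal
  rw [lintegral_comp_eq_lintegral_meas_lt_mul F.law hnn aemeasurable_id'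
    (fun t _ => intervalIntegrable_indicator hx h0 h1 0 t)
    (Eventually.of_forall fun t => indicator_nonneg (fun t _ => h0 t) t),
    ← lintegral_indicator measurableSet_Ioi, F.law_eq_withDensity,
    lintegral_withDensity_eq_lintegral_mul _ F.measurable_density.ennreal_ofReal hmeas,
    ← F.law_eq_withDensity]
  refine lintegral_congr fun t => ?_
  by_cases ht : t ∈ interior F.support
  · have hp := F.pdf_pos t ht
    rw [indicator_of_mem (mem_Ioi.2 (F.pos_of_mem_interior ht)), indicator_of_mem ht]
    simp only [Pi.mul_apply]
    rw [density, indicator_of_mem ht, ← ENNReal.ofReal_mul (F.pdf_nonneg t)]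
    change F.law (Ioi t) * _ = _
    rw [law_Ioi, ← ENNReal.ofReal_mul (sub_nonneg.2 (F.cdf_le_one t))]
    congr 1
    field_simp
  · simp [density, ht, indicator]

lemma ae_nonneg_div (h0 : ∀ t, 0 ≤ x t) :
    0 ≤ᵐ[F.law] fun s => x s * ((1 - F.cdf s) / F.pdf s) :=
  Eventually.of_forall fun s => mul_nonneg (h0 s)
    (div_nonneg (sub_nonneg.2 (F.cdf_le_one s)) (F.pdf_nonneg s))

lemma ae_nonneg_rent (h0 : ∀ t, 0 ≤ x t) :
    0 ≤ᵐ[F.law] fun s => ∫ t in (0 : ℝ)..s, (interior F.support).indicator x t :=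
  F.ae_mem_interior.mono fun _ hs => rent_nonneg h0 (F.nonneg_of_mem_interior hs)

lemma aestronglyMeasurable_div (hx : Measurable x) :
    AEStronglyMeasurable (fun s => x s * ((1 - F.cdf s) / F.pdf s)) F.law :=
  (hx.mul ((measurable_const.sub F.continuous_cdf.measurable).div
    F.measurable_pdf)).aestronglyMeasurable

lemma IsMHR.integrable_div (hF : F.IsMHR) (hx : Measurable x) (h0 : ∀ t, 0 ≤ x t)
    (h1 : ∀ t, x t ≤ 1) : Integrable (fun s => x s * ((1 - F.cdf s) / F.pdf s)) F.law := by
  refine ⟨aestronglyMeasurable_div hx, ?_⟩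
  rw [hasFiniteIntegral_iff_ofReal (ae_nonneg_div h0), ← lintegral_rent hx h0 h1,
    ← hasFiniteIntegral_iff_ofReal (ae_nonneg_rent h0)]
  exact (hF.integrable_rent hx h0 h1).2

/-- The expected information rent of an allocation rule. -/
lemma IsMHR.integral_rent (hF : F.IsMHR) (hx : Measurable x) (h0 : ∀ t, 0 ≤ x t)
    (h1 : ∀ t, x t ≤ 1) :
    ∫ s, (∫ t in (0 : ℝ)..s, (interior F.support).indicator x t) ∂F.law =
      ∫ s, x s * ((1 - F.cdf s) / F.pdf s) ∂F.law := by
  rw [integral_eq_lintegral_of_nonneg_ae (ae_nonneg_rent h0)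
      (hF.integrable_rent hx h0 h1).1,
    integral_eq_lintegral_of_nonneg_ae (ae_nonneg_div h0) (aestronglyMeasurable_div hx),
    lintegral_rent hx h0 h1]

end InformationRent

instance (F : ValuationDistribution) (n : ℕ) : IsProbabilityMeasure (F.profileLaw n) := by
  unfold profileLaw
  infer_instance

lemma measurable_update_prod {n : ℕ} (i : Fin n) :
    Measurable fun p : ℝ × (Fin n → ℝ) => Function.update p.2 i p.1 := by
  refine measurable_pi_lambda _ fun j => ?_
  by_cases h : j = i
  · subst h
    simpa using measurable_fst
  · simp only [Function.update_of_ne h]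
    fun_prop

/-- Resampling one coordinate preserves the law of the profile. -/
lemma measurePreserving_update (F : ValuationDistribution) {n : ℕ} (i : Fin n) :
    MeasurePreserving (fun p : ℝ × (Fin n → ℝ) => Function.update p.2 i p.1)
      (F.law.prod (F.profileLaw n)) (F.profileLaw n) := by
  have hmeas := measurable_update_prod i
  refine ⟨hmeas, Eq.symm (Measure.pi_eq fun s hs => ?_)⟩
  rw [Measure.map_apply hmeas (MeasurableSet.univ_pi hs)]
  have hpre : (fun p : ℝ × (Fin n → ℝ) => Function.update p.2 i p.1) ⁻¹' (univ.pi s) =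
      s i ×ˢ univ.pi (Function.update s i univ) := by
    ext p
    simp only [mem_preimage, mem_univ_pi, mem_prod]
    constructor
    · intro h
      refine ⟨by simpa using h i, fun j => ?_⟩
      by_cases hj : j = i
      · subst hj
        simp
      · simpa [Function.update_of_ne hj] using h j
    · rintro ⟨h1, h2⟩ j
      by_cases hj : j = i
      · subst hj
        simpa using h1
      · simpa [Function.update_of_ne hj] using h2 j
  rw [hpre, Measure.prod_prod, profileLaw, Measure.pi_pi,
    ← Finset.mul_prod_erase Finset.univ (fun j => F.law (s j)) (Finset.mem_univ i),
    ← Finset.mul_prod_erase Finset.univ _ (Finset.mem_univ i)]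
  simp only [Function.update_self, measure_univ, one_mul]
  congr 1
  refine Finset.prod_congr rfl fun j hj => ?_
  rw [Function.update_of_ne (Finset.ne_of_mem_erase hj)]

lemma integrable_interim {n : ℕ} (i : Fin n) {H : (Fin n → ℝ) → ℝ}
    (hH : Integrable H (F.profileLaw n)) :
    Integrable (fun r => ∫ w, H (Function.update w i r) ∂F.profileLaw n) F.law :=
  ((F.measurePreserving_update i).integrable_comp_of_integrable hH).integral_prod_left

/-- Tower property: ex ante expectations are averages of interim ones, since resampling coordinate i
preserves the law. -/
lemma integral_interim {n : ℕ} (i : Fin n) {H : (Fin n → ℝ) → ℝ}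
    (hH : Integrable H (F.profileLaw n)) :
    ∫ w, H w ∂F.profileLaw n =
      ∫ r, ∫ w, H (Function.update w i r) ∂F.profileLaw n ∂F.law := by
  have h2 := integral_prod (fun p : ℝ × (Fin n → ℝ) => H (Function.update p.2 i p.1))
    ((F.measurePreserving_update i).integrable_comp_of_integrable hH)
  rw [← h2]
  nth_rw 1 [← (F.measurePreserving_update i).map_eq]
  refine (integral_map (measurable_update_prod i).aemeasurable ?_)
  rw [(F.measurePreserving_update i).map_eq]
  exact hH.1

lemma measurePreserving_coord (F : ValuationDistribution) {n : ℕ} (i : Fin n) :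
    MeasurePreserving (fun w : Fin n → ℝ => w i) (F.profileLaw n) F.law :=
  measurePreserving_eval (fun _ => F.law) i

end ValuationDistribution

/-! ### Envelope bound and Myerson's upper bound on revenue -/

namespace Mechanism

open ValuationDistribution

variable {n : ℕ} (M : Mechanism n) (F : ValuationDistribution)

/-- The interim allocation probability of bidder `i` reporting `r`. -/
def interimAlloc (i : Fin n) (r : ℝ) : ℝ :=
  ∫ w, M.alloc (Function.update w i r) i ∂F.profileLaw n

/-- The interim expected payment of bidder `i` reporting `r`. -/
def interimPay (i : Fin n) (r : ℝ) : ℝ :=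
  ∫ w, M.pay (Function.update w i r) i ∂F.profileLaw n

lemma alloc_le_one (b : Fin n → ℝ) (i : Fin n) : M.alloc b i ≤ 1 :=
  (Finset.single_le_sum (fun j _ => M.alloc_nonneg b j) (Finset.mem_univ i)).trans
    (M.sum_alloc_le_one b)

lemma measurable_alloc_apply (i : Fin n) : Measurable fun w => M.alloc w i :=
  (measurable_pi_apply i).comp M.measurable_alloc

lemma integrable_of_alloc {Ω : Type*} [MeasurableSpace Ω] (μ : Measure Ω) [IsFiniteMeasure μ]
    {g : Ω → Fin n → ℝ} (hg : Measurable g) (i : Fin n) :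
    Integrable (fun w => M.alloc (g w) i) μ := by
  refine (integrable_const (1 : ℝ)).mono'
    ((M.measurable_alloc_apply i).comp hg).aestronglyMeasurable (Eventually.of_forall fun w => ?_)
  rw [Real.norm_of_nonneg (M.alloc_nonneg _ _)]
  exact M.alloc_le_one _ _

lemma measurable_update_report (i : Fin n) (r : ℝ) :
    Measurable fun w : Fin n → ℝ => Function.update w i r :=
  (measurable_update_prod i).comp (measurable_const.prodMk measurable_id)

lemma measurable_interimAlloc (i : Fin n) : Measurable (M.interimAlloc F i) := by
  have h : StronglyMeasurable fun p : ℝ × (Fin n → ℝ) => M.alloc (Function.update p.2 i p.1) i :=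
    ((M.measurable_alloc_apply i).comp (measurable_update_prod i)).stronglyMeasurable
  exact h.integral_prod_right.measurable

lemma interimAlloc_nonneg (i : Fin n) (r : ℝ) : 0 ≤ M.interimAlloc F i r :=
  integral_nonneg fun _ => M.alloc_nonneg _ _

lemma interimAlloc_le_one (i : Fin n) (r : ℝ) : M.interimAlloc F i r ≤ 1 := by
  have h := integral_mono (M.integrable_of_alloc (F.profileLaw n) (measurable_update_report i r) i)
    (integrable_const (1 : ℝ)) fun w => M.alloc_le_one _ _
  simpa [interimAlloc] using h

variable {M F}

lemma interimUtility_eq (hE : M.HasExpectedPayments F) (i : Fin n) (v : ℝ) {r : ℝ}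
    (hr : r ∈ F.support) :
    M.interimUtility F i v r = v * M.interimAlloc F i r - M.interimPay F i r := by
  rw [interimUtility, integral_sub _ ((hE i).2 r hr), integral_const_mul]
  · rfl
  · exact (M.integrable_of_alloc _ (measurable_update_report i r) i).const_mul v

/-- The envelope bound for truthful utilities. -/
lemma rent_le_interimUtility (hE : M.HasExpectedPayments F) (hT : M.IsTruthful F)
    (hR : M.IsIndividuallyRational F) (i : Fin n) {s : ℝ} (hs : s ∈ interior F.support) :
    ∫ t in (0 : ℝ)..s, (interior F.support).indicator (M.interimAlloc F i) t ≤
      M.interimUtility F i s s := by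
  set I := interior F.support with hI
  set x := M.interimAlloc F i with hx
  have hxm : Measurable x := M.measurable_interimAlloc F i
  have hx0 : ∀ t, 0 ≤ x t := M.interimAlloc_nonneg F i
  have hx1 : ∀ t, x t ≤ 1 := M.interimAlloc_le_one F i
  have hii : ∀ a b, IntervalIntegrable (I.indicator x) volume a b :=
    fun a b => intervalIntegrable_indicator hxm hx0 hx1 a b
  have hsub : ∀ p ∈ I, ∀ q ∈ I,
      (q - p) * x p ≤ M.interimUtility F i q q - M.interimUtility F i p p := fun p hp q hq => by
    have hp' := interior_subset hp
    have h := hT i q (interior_subset hq) p hp'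
    rw [interimUtility_eq hE i q hp'] at h
    rw [interimUtility_eq hE i p hp']
    linarith
  set k := ∫ t in (0 : ℝ)..s, I.indicator x t with hk
  -- Individual rationality at a plus the subgradient estimate from a to s gives the rent
  -- accumulated above a; afterwards a is pushed to the left end point, which need not be in the
  -- support.
  have hmem : ∀ a ∈ I, k - ∫ t in (0 : ℝ)..a, I.indicator x t ≤ M.interimUtility F i s s := by
    intro a ha
    rw [hk, intervalIntegral.integral_interval_sub_left (hii _ _) (hii _ _)]
    rcases le_total a s with has | has
    · have h1 := intervalIntegral_le_sub_of_subgradient isOpen_interior F.ordConnected_interior hxm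
        (B := 1) (fun t => by rw [Real.norm_of_nonneg (hx0 t)]; exact hx1 t) hsub ha hs has
      have h2 : ∫ t in a..s, I.indicator x t = ∫ t in a..s, x t :=
        intervalIntegral.integral_congr fun t ht =>
          indicator_of_mem (F.ordConnected_interior.uIcc_subset ha hs ht) x
      rw [h2]
      exact h1.trans (sub_le_self _ (hR i a (interior_subset ha)))
    · rw [intervalIntegral.integral_symm]
      refine le_trans (neg_nonpos.2 ?_) (hR i s (interior_subset hs))
      exact intervalIntegral.integral_nonneg has fun t _ => indicator_nonneg (fun t _ => hx0 t) t
  have hcl : IsClosed {a | k - ∫ t in (0 : ℝ)..a, I.indicator x t ≤ M.interimUtility F i s s} :=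
    isClosed_le (continuous_const.sub (intervalIntegral.continuous_primitive hii 0))
      continuous_const
  have h : k - ∫ t in (0 : ℝ)..sInf I, I.indicator x t ≤ M.interimUtility F i s s :=
    closure_minimal hmem hcl (csInf_mem_closure ⟨s, hs⟩ F.bddBelow_interior)
  have h0 : ∫ t in (0 : ℝ)..sInf I, I.indicator x t = 0 := by
    refine (intervalIntegral.integral_congr (g := fun _ => (0 : ℝ)) fun t ht => ?_).trans
      intervalIntegral.integral_zero
    rw [uIcc_of_le F.sInf_interior_nonneg] at ht
    refine indicator_of_notMem (fun htI => ?_) x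
    exact F.sInf_notMem_interior
      (le_antisymm ht.2 (csInf_le F.bddBelow_interior htI) ▸ htI)
  rwa [h0, sub_zero] at h

/-- A bidder's expected payment is at most her expected virtual surplus. -/
lemma integral_pay_le (hF : F.IsMHR) (hE : M.HasExpectedPayments F) (hT : M.IsTruthful F)
    (hR : M.IsIndividuallyRational F) (i : Fin n) :
    ∫ w, M.pay w i ∂F.profileLaw n ≤ ∫ w, M.alloc w i * F.posVirtual (w i) ∂F.profileLaw n := by
  set x := M.interimAlloc F i with hx
  have hxm : Measurable x := M.measurable_interimAlloc F i
  have hx0 : ∀ t, 0 ≤ x t := M.interimAlloc_nonneg F i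
  have hx1 : ∀ t, x t ≤ 1 := M.interimAlloc_le_one F i
  have hxn : ∀ t, ‖x t‖ ≤ 1 := fun t => by rw [Real.norm_of_nonneg (hx0 t)]; exact hx1 t
  have hint : Integrable (fun w => M.alloc w i * F.posVirtual (w i)) (F.profileLaw n) :=
    ((F.measurePreserving_coord i).integrable_comp_of_integrable
      hF.integrable_posVirtual).bdd_mul
      (M.measurable_alloc_apply i).aestronglyMeasurable (c := 1)
      (Eventually.of_forall fun w => by
        rw [Real.norm_of_nonneg (M.alloc_nonneg _ _)]; exact M.alloc_le_one _ _)
  have hsx : Integrable (fun s => x s * s) F.law :=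
    hF.integrable_id.bdd_mul hxm.aestronglyMeasurable (Eventually.of_forall hxn)
  rw [integral_interim i (hE i).1, integral_interim i hint]
  have hrhs : ∀ s, ∫ w, M.alloc (Function.update w i s) i *
      F.posVirtual (Function.update w i s i) ∂F.profileLaw n = x s * F.posVirtual s := fun s => by
    simp only [Function.update_self]
    rw [integral_mul_const]
    rfl
  simp only [hrhs]
  -- Payment is value times allocation minus utility; the utility is at least the rent, whose mean
  -- is that of x(1 - F)/f.
  calc ∫ s, M.interimPay F i s ∂F.law
      ≤ ∫ s, (x s * s - ∫ t in (0 : ℝ)..s, (interior F.support).indicator x t) ∂F.law := by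
        refine integral_mono_ae (integrable_interim i (hE i).1)
          (hsx.sub (hF.integrable_rent hxm hx0 hx1)) ?_
        filter_upwards [F.ae_mem_interior] with s hs
        have h := rent_le_interimUtility hE hT hR i hs
        rw [interimUtility_eq hE i s (interior_subset hs)] at h
        linarith
    _ = ∫ s, (x s * s - x s * ((1 - F.cdf s) / F.pdf s)) ∂F.law := by
        rw [integral_sub hsx (hF.integrable_rent hxm hx0 hx1), hF.integral_rent hxm hx0 hx1,
          ← integral_sub hsx (hF.integrable_div hxm hx0 hx1)]
    _ ≤ ∫ s, x s * F.posVirtual s ∂F.law := by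
        refine integral_mono (hsx.sub (hF.integrable_div hxm hx0 hx1))
          (hF.integrable_posVirtual.bdd_mul hxm.aestronglyMeasurable (Eventually.of_forall hxn))
          fun s => ?_
        rw [← mul_sub]
        refine mul_le_mul_of_nonneg_left ?_ (hx0 s)
        refine le_trans (le_of_eq ?_) (le_max_left _ _)
        rw [virtualValuation, one_mul]

lemma measurableSet_isMax (i : Fin n) : MeasurableSet {w : Fin n → ℝ | ∀ j, w j ≤ w i} := by
  simp only [ofPred_forall]
  exact MeasurableSet.iInter fun j =>
    measurableSet_le (measurable_pi_apply j) (measurable_pi_apply i)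

lemma profileLaw_real_isMax (F : ValuationDistribution) (i : Fin n) (s : ℝ) :
    (F.profileLaw n).real {w | ∀ j, Function.update w i s j ≤ s} = F.cdf s ^ (n - 1) := by
  have hset : {w : Fin n → ℝ | ∀ j, Function.update w i s j ≤ s} =
      univ.pi (Function.update (fun _ => Iic s) i univ) := by
    ext w
    simp only [mem_ofPred_eq, mem_univ_pi]
    refine forall_congr' fun j => ?_
    by_cases hj : j = i
    · subst hj
      simp
    · simp [Function.update_of_ne hj]
  rw [hset, profileLaw, measureReal_def, Measure.pi_pi, ENNReal.toReal_prod,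
    ← Finset.mul_prod_erase Finset.univ _ (Finset.mem_univ i)]
  simp only [Function.update_self, measure_univ, ENNReal.toReal_one, one_mul]
  have h : ∀ j ∈ Finset.univ.erase i,
      (F.law (Function.update (fun _ => Iic s) i univ j)).toReal = F.cdf s := fun j hj => by
    rw [Function.update_of_ne (Finset.ne_of_mem_erase hj), ← measureReal_def, law_real_Iic]
  rw [Finset.prod_congr rfl h, Finset.prod_const, Finset.card_erase_of_mem (Finset.mem_univ i),
    Finset.card_univ, Fintype.card_fin]

/-- Revenue is at most the expected virtual valuation of the highest bidder. -/
lemma expectedRevenue_le (hn : 0 < n) (hF : F.IsMHR) (hE : M.HasExpectedPayments F)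
    (hT : M.IsTruthful F) (hR : M.IsIndividuallyRational F) :
    M.expectedRevenue F ≤ n * ∫ s, F.posVirtual s * F.cdf s ^ (n - 1) ∂F.law := by
  have hpv : ∀ i : Fin n, Integrable (fun w : Fin n → ℝ => F.posVirtual (w i)) (F.profileLaw n) :=
    fun i => (F.measurePreserving_coord i).integrable_comp_of_integrable hF.integrable_posVirtual
  have hint : ∀ i : Fin n, Integrable (fun w => M.alloc w i * F.posVirtual (w i))
      (F.profileLaw n) := fun i =>
    (hpv i).bdd_mul (M.measurable_alloc_apply i).aestronglyMeasurable (c := 1)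
      (Eventually.of_forall fun w => by
        rw [Real.norm_of_nonneg (M.alloc_nonneg _ _)]; exact M.alloc_le_one _ _)
  have hmax : ∀ i : Fin n, Integrable ({w : Fin n → ℝ | ∀ j, w j ≤ w i}.indicator
      fun w => F.posVirtual (w i)) (F.profileLaw n) := fun i =>
    (hpv i).indicator (measurableSet_isMax i)
  have hae : ∀ᵐ w ∂F.profileLaw n, ∀ i, w i ∈ interior F.support := by
    rw [ae_all_iff]
    exact fun i => (F.measurePreserving_coord i).quasiMeasurePreserving.ae F.ae_mem_interior
  rw [expectedRevenue, integral_finsetSum _ fun i _ => (hE i).1]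
  calc ∑ i, ∫ w, M.pay w i ∂F.profileLaw n
      ≤ ∑ i, ∫ w, M.alloc w i * F.posVirtual (w i) ∂F.profileLaw n :=
        Finset.sum_le_sum fun i _ => integral_pay_le hF hE hT hR i
    _ = ∫ w, ∑ i, M.alloc w i * F.posVirtual (w i) ∂F.profileLaw n :=
        (integral_finsetSum _ fun i _ => hint i).symm
    -- By monotonicity the surplus is largest when a highest bidder wins. Ties make several
    -- indicators 1, which only enlarges the right side.
    _ ≤ ∫ w, ∑ i, {w : Fin n → ℝ | ∀ j, w j ≤ w i}.indicator
          (fun w => F.posVirtual (w i)) w ∂F.profileLaw n := by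
        refine integral_mono_ae (integrable_finsetSum _ fun i _ => hint i)
          (integrable_finsetSum _ fun i _ => hmax i) ?_
        filter_upwards [hae] with w hw
        have : Nonempty (Fin n) := ⟨⟨0, hn⟩⟩
        obtain ⟨m, -, hm⟩ := Finset.exists_max_image Finset.univ w Finset.univ_nonempty
        calc ∑ i, M.alloc w i * F.posVirtual (w i)
            ≤ ∑ i, M.alloc w i * F.posVirtual (w m) :=
              Finset.sum_le_sum fun i _ => mul_le_mul_of_nonneg_left
                (hF.monotoneOn_posVirtual (hw i) (hw m) (hm i (Finset.mem_univ i)))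
                (M.alloc_nonneg w i)
          _ = (∑ i, M.alloc w i) * F.posVirtual (w m) := (Finset.sum_mul ..).symm
          _ ≤ 1 * F.posVirtual (w m) :=
              mul_le_mul_of_nonneg_right (M.sum_alloc_le_one w) (F.posVirtual_nonneg _)
          _ = {w : Fin n → ℝ | ∀ j, w j ≤ w m}.indicator (fun w => F.posVirtual (w m)) w := by
              rw [one_mul, indicator_of_mem]
              exact fun j => hm j (Finset.mem_univ j)
          _ ≤ _ := Finset.single_le_sum
              (f := fun i => {w : Fin n → ℝ | ∀ j, w j ≤ w i}.indicator
                (fun w => F.posVirtual (w i)) w)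
              (fun i _ => indicator_nonneg (fun w _ => F.posVirtual_nonneg (w i)) w)
              (Finset.mem_univ m)
    _ = ∑ i : Fin n, ∫ s, F.posVirtual s * F.cdf s ^ (n - 1) ∂F.law := by
        rw [integral_finsetSum _ fun i _ => hmax i]
        refine Finset.sum_congr rfl fun i _ => ?_
        rw [integral_interim i (hmax i)]
        refine integral_congr_ae (Eventually.of_forall fun s => ?_)
        have hind : ∀ w : Fin n → ℝ, {w : Fin n → ℝ | ∀ j, w j ≤ w i}.indicator
            (fun w => F.posVirtual (w i)) (Function.update w i s) =
            {w : Fin n → ℝ | ∀ j, Function.update w i s j ≤ s}.indicator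
              (fun _ => F.posVirtual s) w := fun w => by
          simp only [indicator, mem_ofPred_eq, Function.update_self]
        simp only [hind]
        have hms : MeasurableSet {w : Fin n → ℝ | ∀ j, Function.update w i s j ≤ s} := by
          have h := measurable_update_report i s (measurableSet_isMax i)
          simpa [preimage] using h
        rw [integral_indicator_const _ hms, profileLaw_real_isMax, smul_eq_mul, mul_comm]
    _ = n * ∫ s, F.posVirtual s * F.cdf s ^ (n - 1) ∂F.law := by
        rw [Finset.sum_const, Finset.card_univ, Fintype.card_fin, nsmul_eq_mul]

end Mechanism

/-! ### Tail of the second highest of n samples -/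

/-- The probability that at least two of `n` independent events of probability `1 - u` occur. -/
def twoTail (n : ℕ) (u : ℝ) : ℝ := 1 - u ^ n - n * u ^ (n - 1) * (1 - u)

lemma twoTail_one_right (n : ℕ) : twoTail n 1 = 0 := by simp [twoTail]

lemma continuous_twoTail (n : ℕ) : Continuous (twoTail n) := by
  unfold twoTail
  fun_prop

lemma hasDerivAt_twoTail (m : ℕ) (u : ℝ) :
    HasDerivAt (twoTail (m + 2)) (-((m + 2) * (m + 1) * u ^ m * (1 - u))) u := by
  have h := ((hasDerivAt_pow (m + 2) u).const_sub 1).sub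
    (((hasDerivAt_pow (m + 1) u).const_mul ((m + 2 : ℕ) : ℝ)).mul ((hasDerivAt_id u).const_sub 1))
  refine (h.congr_deriv ?_)
  simp only [id, Nat.add_sub_cancel, show m + 2 - 1 = m + 1 from rfl]
  push_cast
  ring

lemma antitoneOn_twoTail {n : ℕ} (hn : 2 ≤ n) : AntitoneOn (twoTail n) (Icc 0 1) := by
  obtain ⟨m, rfl⟩ := Nat.exists_eq_add_of_le' hn
  refine antitoneOn_of_deriv_nonpos (convex_Icc 0 1) (continuous_twoTail _).continuousOn
    (fun u _ => (hasDerivAt_twoTail m u).differentiableAt.differentiableWithinAt) fun u hu => ?_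
  rw [interior_Icc] at hu
  rw [(hasDerivAt_twoTail m u).deriv, neg_nonpos]
  have := hu.1.le
  have := sub_nonneg.2 hu.2.le
  positivity

lemma twoTail_nonneg {n : ℕ} (hn : 2 ≤ n) {u : ℝ} (h0 : 0 ≤ u) (h1 : u ≤ 1) :
    0 ≤ twoTail n u := by
  have h := antitoneOn_twoTail hn ⟨h0, h1⟩ ⟨zero_le_one, le_rfl⟩ h1
  rwa [twoTail_one_right] at h

lemma one_sub_pow_le {n : ℕ} {u : ℝ} (h0 : 0 ≤ u) : 1 - u ^ n ≤ n * (1 - u) := by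
  have h := one_add_mul_le_pow (a := u - 1) (by linarith) n
  rw [add_sub_cancel] at h
  linarith

lemma twoTail_le {n : ℕ} {u : ℝ} (h0 : 0 ≤ u) (h1 : u ≤ 1) : twoTail n u ≤ n * (1 - u) := by
  have h := one_sub_pow_le (n := n) h0
  have : 0 ≤ n * u ^ (n - 1) * (1 - u) := by
    have := sub_nonneg.2 h1
    positivity
  rw [twoTail]
  linarith

/-- A primitive of `twoTail (m + 1) / (1 - u)`. -/
def twoTailPrimitive (m : ℕ) (u : ℝ) : ℝ :=
  ∑ k ∈ Finset.range m, (u ^ (k + 1) - (k + 1) / (k + 2) * u ^ (k + 2))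

lemma twoTailPrimitive_zero_right (m : ℕ) : twoTailPrimitive m 0 = 0 := by
  simp [twoTailPrimitive]

/-- At u = 1 the k-th summand is 1/(k + 2), leaving the harmonic sum without its first term. -/
lemma twoTailPrimitive_one_right (m : ℕ) :
    twoTailPrimitive m 1 = (harmonic (m + 1) : ℝ) - 1 := by
  rw [harmonic, Finset.sum_range_succ', twoTailPrimitive]
  push_cast
  simp only [inv_one, add_sub_cancel_right, one_pow]
  refine Finset.sum_congr rfl fun k _ => ?_
  field_simp
  ring

lemma hasDerivAt_twoTailPrimitive (m : ℕ) (u : ℝ) :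
    HasDerivAt (twoTailPrimitive m)
      (∑ k ∈ Finset.range m, (k + 1) * (u ^ k - u ^ (k + 1))) u := by
  unfold twoTailPrimitive
  refine HasDerivAt.fun_sum fun k _ => ?_
  refine ((hasDerivAt_pow (k + 1) u).sub
    ((hasDerivAt_pow (k + 2) u).const_mul _)).congr_deriv ?_
  simp only [Nat.add_sub_cancel, show k + 2 - 1 = k + 1 from rfl]
  push_cast
  field_simp

lemma sum_mul_eq_twoTail (m : ℕ) (u : ℝ) :
    (∑ k ∈ Finset.range m, (k + 1) * (u ^ k - u ^ (k + 1))) * (1 - u) = twoTail (m + 1) u := by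
  induction m with
  | zero => simp [twoTail]
  | succ m ih =>
    rw [Finset.sum_range_succ, add_mul, ih, twoTail, twoTail]
    simp only [Nat.add_sub_cancel]
    push_cast
    ring

/-- The mean of the second highest of `n` independent shifted exponential variables. -/
lemma integral_twoTail_exp {n : ℕ} (hn : 2 ≤ n) {h : ℝ} (hh : 0 < h) (a : ℝ) :
    IntegrableOn (fun s => twoTail n (1 - Real.exp (-(h * (s - a))))) (Ioi a) ∧
    ∫ s in Ioi a, twoTail n (1 - Real.exp (-(h * (s - a)))) = ((harmonic n : ℝ) - 1) / h := by
  obtain ⟨m, rfl⟩ : ∃ m, n = m + 1 := ⟨n - 1, by omega⟩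
  have hu : ∀ s, HasDerivAt (fun s => 1 - Real.exp (-(h * (s - a))))
      (h * Real.exp (-(h * (s - a)))) s := fun s => by
    refine (((((hasDerivAt_id s).sub_const a).const_mul h).neg.exp).const_sub 1).congr_deriv ?_
    simp only [id, Pi.neg_apply]
    ring
  -- For u = 1 - exp(-h(s - a)) one has u' = h(1 - u), which cancels the denominator in the
  -- derivative of the primitive.
  have hd : ∀ s, HasDerivAt (fun s => twoTailPrimitive m (1 - Real.exp (-(h * (s - a)))) / h)
      (twoTail (m + 1) (1 - Real.exp (-(h * (s - a))))) s := fun s => by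
    refine (((hasDerivAt_twoTailPrimitive m _).comp s (hu s)).div_const h).congr_deriv ?_
    rw [← sum_mul_eq_twoTail]
    field_simp
    ring
  have hlim : Tendsto (fun s => twoTailPrimitive m (1 - Real.exp (-(h * (s - a)))) / h) atTop
      (𝓝 (((harmonic (m + 1) : ℝ) - 1) / h)) := by
    rw [← twoTailPrimitive_one_right]
    refine Tendsto.div_const ?_ h
    refine ((hasDerivAt_twoTailPrimitive m 1).continuousAt.tendsto).comp ?_
    have h1 : Tendsto (fun s => h * (s - a)) atTop atTop :=
      (tendsto_atTop_add_const_right _ (-a) tendsto_id).const_mul_atTop hh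
    have h2 := Real.tendsto_exp_neg_atTop_nhds_zero.comp h1
    simpa using h2.const_sub 1
  have hnn : ∀ s ∈ Ioi a, 0 ≤ twoTail (m + 1) (1 - Real.exp (-(h * (s - a)))) := fun s hs => by
    have h3 : 0 ≤ h * (s - a) := mul_nonneg hh.le (sub_nonneg.2 (le_of_lt hs))
    have h4 : Real.exp (-(h * (s - a))) ≤ 1 := Real.exp_le_one_iff.2 (neg_nonpos.2 h3)
    exact twoTail_nonneg hn (sub_nonneg.2 h4) (by linarith [Real.exp_pos (-(h * (s - a)))])
  refine ⟨integrableOn_Ioi_deriv_of_nonneg' (fun s _ => hd s) hnn hlim, ?_⟩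
  rw [integral_Ioi_of_hasDerivAt_of_nonneg' (fun s _ => hd s) hnn hlim]
  simp [twoTailPrimitive_zero_right]

/-! ### Second highest value under MHR -/

namespace ValuationDistribution

variable {F : ValuationDistribution}

lemma IsMHR.integrableOn_twoTail (hF : F.IsMHR) {n : ℕ} (hn : 2 ≤ n) :
    IntegrableOn (fun s => twoTail n (F.cdf s)) (Ioi 0) := by
  refine Integrable.mono' (hF.integrableOn_survival.const_mul n)
    ((continuous_twoTail n).comp F.continuous_cdf).aestronglyMeasurable.restrict
    (Eventually.of_forall fun s => ?_)
  rw [Real.norm_of_nonneg (twoTail_nonneg hn (F.cdf_nonneg s) (F.cdf_le_one s))]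
  exact twoTail_le (F.cdf_nonneg s) (F.cdf_le_one s)

/-- The expected second highest valuation is at most the `1 - exp (1 - H_n)` quantile. -/
lemma IsMHR.integral_twoTail_le (hF : F.IsMHR) {n : ℕ} (hn : 2 ≤ n) {x : ℝ}
    (hx : x ∈ interior F.support) (hFx : F.cdf x = 1 - Real.exp (-((harmonic n : ℝ) - 1))) :
    ∫ s in Ioi 0, twoTail n (F.cdf s) ≤ x := by
  set t := (harmonic n : ℝ) - 1 with ht
  set h := F.hazard x with hh
  have hpos : 0 < h := F.hazard_pos hx
  -- Here the tangent to log(1 - F) at x reaches 0. The exponential with rate h started at a has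
  -- second-order-statistic mean a + t/h = x.
  set a := x - t / h with ha
  have ha0 : 0 ≤ a := by
    have h1 := hF.neg_log_survival_le hx
    rw [hFx, sub_sub_cancel, Real.log_exp, neg_neg] at h1
    rw [ha, sub_nonneg, div_le_iff₀ hpos]
    exact h1
  have hdom : ∀ s, 1 - Real.exp (-(h * (s - a))) ≤ F.cdf s := fun s => by
    have h1 := hF.survival_le_exp hx s
    rw [hFx, sub_sub_cancel, ← Real.exp_add] at h1
    have h2 : -t + -(h * (s - x)) = -(h * (s - a)) := by
      rw [ha]
      field_simp
      ring
    rw [h2] at h1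
    linarith
  obtain ⟨hint, hval⟩ := integral_twoTail_exp hn hpos a
  have hi := hF.integrableOn_twoTail hn
  rw [← Ioc_union_Ioi_eq_Ioi ha0, setIntegral_union (Ioc_disjoint_Ioi le_rfl) measurableSet_Ioi
    (hi.mono_set Ioc_subset_Ioi_self) (hi.mono_set (Ioi_subset_Ioi ha0))]
  have h1 : ∫ s in Ioc 0 a, twoTail n (F.cdf s) ≤ a := by
    have h := setIntegral_mono_on (s := Ioc 0 a) (hi.mono_set Ioc_subset_Ioi_self)
      (integrableOn_const (C := (1 : ℝ)) measure_Ioc_lt_top.ne) measurableSet_Ioc fun s _ => by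
        have h1 := antitoneOn_twoTail hn ⟨le_rfl, zero_le_one⟩ ⟨F.cdf_nonneg s, F.cdf_le_one s⟩
          (F.cdf_nonneg s)
        have h2 : twoTail n 0 ≤ 1 := by
          have h3 : (0 : ℝ) ^ (n - 1) = 0 := zero_pow (by omega)
          simp [twoTail, h3]
        exact h1.trans h2
    simpa [ha0] using h
  have h2 : ∫ s in Ioi a, twoTail n (F.cdf s) ≤ t / h := by
    rw [← hval]
    refine setIntegral_mono_on (hi.mono_set (Ioi_subset_Ioi ha0)) hint measurableSet_Ioi
      fun s hs => ?_
    have h3 : Real.exp (-(h * (s - a))) ≤ 1 := Real.exp_le_one_iff.2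
      (neg_nonpos.2 (mul_nonneg hpos.le (sub_nonneg.2 (le_of_lt hs))))
    exact antitoneOn_twoTail hn ⟨sub_nonneg.2 h3, by linarith [Real.exp_pos (-(h * (s - a)))]⟩
      ⟨F.cdf_nonneg s, F.cdf_le_one s⟩ (hdom s)
  linarith

/-- Log-concavity gives S(s) ≥ S(r)^(s/r). Weakening this by convexity of exp, applied to 1/S,
interpolates 1/S linearly between 0 and r and yields a rational bound that integrates in closed
form. -/
lemma IsMHR.cdf_le_of_le (hF : F.IsMHR) {r s : ℝ} (hr : 0 < r) (hq : F.cdf r < 1) (hs0 : 0 ≤ s)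
    (hsr : s ≤ r) : F.cdf s ≤ s * F.cdf r / (r * (1 - F.cdf r) + s * F.cdf r) := by
  set q := F.cdf r with hqdef
  have hq0 : 0 ≤ q := F.cdf_nonneg r
  have hp : 0 < 1 - q := sub_pos.2 hq
  set c := s / r with hc
  have hc0 : 0 ≤ c := div_nonneg hs0 hr.le
  have hc1 : c ≤ 1 := (div_le_one hr).2 hsr
  have hs : c * r = s := div_mul_cancel₀ s hr.ne'
  have h1 := hF.survival_mul_ge hq hc0 hc1
  rw [hs] at h1
  have h2 := convexOn_exp.2 (mem_univ (0 : ℝ)) (mem_univ (-Real.log (1 - q)))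
    (sub_nonneg.2 hc1) hc0 (sub_add_cancel 1 c)
  simp only [smul_eq_mul, mul_zero, zero_add, Real.exp_zero, mul_one] at h2
  rw [mul_neg, Real.exp_neg, Real.exp_neg, Real.exp_log hp] at h2
  have h3 : (1 - q) / (1 - q + c * q) ≤ Real.exp (c * Real.log (1 - q)) := by
    have hpos : 0 < 1 - q + c * q := by positivity
    rw [inv_le_iff_one_le_mul₀ (Real.exp_pos _)] at h2
    rw [div_le_iff₀ hpos]
    have h4 : 1 - c + c * (1 - q)⁻¹ = (1 - q + c * q) / (1 - q) := by
      field_simp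
      ring
    rw [h4, div_mul_eq_mul_div, le_div_iff₀ hp] at h2
    linarith
  have h5 : s * q / (r * (1 - q) + s * q) = 1 - (1 - q) / (1 - q + c * q) := by
    rw [← hs]
    have : 0 < 1 - q + c * q := by positivity
    field_simp
    ring
  rw [h5]
  linarith

/-- The rational majorant G of F satisfies sG' = G(1 - G), so s(1 - G^(n-1)) is an exact primitive
of `twoTail n (G s)`; `twoTail` is antitone. -/
lemma IsMHR.le_integral_twoTail (hF : F.IsMHR) {n : ℕ} (hn : 2 ≤ n) {r : ℝ} (hr : 0 ≤ r)
    (hq : F.cdf r < 1) :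
    r * (1 - F.cdf r ^ (n - 1)) ≤ ∫ s in (0 : ℝ)..r, twoTail n (F.cdf s) := by
  rcases eq_or_lt_of_le hr with rfl | hr
  · simp
  have hqn := F.cdf_nonneg r
  have hdom := fun s (h0 : 0 ≤ s) (h1 : s ≤ r) => hF.cdf_le_of_le hr hq h0 h1
  generalize F.cdf r = q at *
  have hp : 0 < 1 - q := sub_pos.2 hq
  obtain ⟨m, rfl⟩ : ∃ m, n = m + 2 := ⟨n - 2, by omega⟩
  set G : ℝ → ℝ := fun s => s * q / (r * (1 - q) + s * q) with hG
  have hden : ∀ s, 0 ≤ s → 0 < r * (1 - q) + s * q := fun s hs => by positivity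
  have hd : ∀ s, 0 ≤ s → HasDerivAt (fun s => s * (1 - G s ^ (m + 1))) (twoTail (m + 2) (G s)) s :=
    fun s hs => by
    have hne := (hden s hs).ne'
    have h1 : HasDerivAt G (q * (r * (1 - q)) / (r * (1 - q) + s * q) ^ 2) s := by
      refine (((hasDerivAt_id s).mul_const q).div
        (((hasDerivAt_id s).mul_const q).const_add (r * (1 - q))) hne).congr_deriv ?_
      simp only [id]
      congr 1
      ring
    refine ((hasDerivAt_id s).mul ((h1.pow (m + 1)).const_sub 1)).congr_deriv ?_
    have h2 : s * (q * (r * (1 - q)) / (r * (1 - q) + s * q) ^ 2) = G s * (1 - G s) := by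
      simp only [hG]
      field_simp
      ring
    simp only [id, twoTail, Nat.add_sub_cancel, show m + 2 - 1 = m + 1 from rfl, Pi.pow_apply]
    push_cast
    linear_combination (-(m + 1) * G s ^ m) * h2
  have hcont : ContinuousOn (fun s => twoTail (m + 2) (G s)) (uIcc 0 r) := by
    refine (continuous_twoTail _).comp_continuousOn ?_
    refine ContinuousOn.div (by fun_prop) (by fun_prop) fun s hs => ?_
    rw [uIcc_of_le hr.le] at hs
    exact (hden s hs.1).ne'
  have hval := intervalIntegral.integral_eq_sub_of_hasDerivAt
    (fun s hs => hd s (by rw [uIcc_of_le hr.le] at hs; exact hs.1)) hcont.intervalIntegrable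
  have hGr : G r = q := by
    simp only [hG]
    field_simp
    ring
  simp only [hGr, zero_mul, sub_zero] at hval
  rw [show m + 2 - 1 = m + 1 from rfl, ← hval]
  refine intervalIntegral.integral_mono_on hr.le hcont.intervalIntegrable
    ((continuous_twoTail _).comp F.continuous_cdf).continuousOn.intervalIntegrable fun s hs => ?_
  have hG1 : G s ≤ 1 := by
    rw [div_le_one (hden s hs.1)]
    have := mul_pos hr hp
    linarith
  have hG0 : 0 ≤ G s := div_nonneg (mul_nonneg hs.1 hqn) (hden s hs.1).le
  exact antitoneOn_twoTail hn ⟨F.cdf_nonneg s, F.cdf_le_one s⟩ ⟨hG0, hG1⟩ (hdom s hs.1 hs.2)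

end ValuationDistribution

/-! ### From virtual surplus to a quantile plus a reserve correction -/

namespace ValuationDistribution

variable {F : ValuationDistribution}

/-- The expected positive part of the highest virtual valuation, in terms of the probabilities
that a price is accepted by at least one and by at least two bidders. -/
lemma IsMHR.integral_posVirtual_le (hF : F.IsMHR) {n : ℕ} (hn : 2 ≤ n) {r : ℝ} (hr : 0 ≤ r)
    (hlow : ∀ s ∈ interior F.support, s < r → s * F.hazard s ≤ 1)
    (hhigh : ∀ s ∈ interior F.support, r < s → 1 < s * F.hazard s) :
    n * ∫ s, F.posVirtual s * F.cdf s ^ (n - 1) ∂F.law ≤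
      r * (1 - F.cdf r ^ n) + ∫ s in Ioi r, twoTail n (F.cdf s) := by
  set G : ℝ → ℝ := fun s => F.density s * (F.posVirtual s * F.cdf s ^ (n - 1)) with hG
  set K : ℝ → ℝ := fun s => F.cdf s ^ (n - 1) * (s * F.density s - (1 - F.cdf s)) with hK
  have hGK : ∀ s, s ≠ r → G s = (Ioi r).indicator K s := by
    intro s hsr
    by_cases hs : s ∈ interior F.support
    · have hp := F.pdf_pos s hs
      have hS := sub_pos.2 (F.cdf_lt_one hs)
      have hval : F.virtualValuation 1 s * F.pdf s = s * F.pdf s - (1 - F.cdf s) := by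
        rw [virtualValuation]
        field_simp
      have hhaz : s * F.hazard s * (1 - F.cdf s) = s * F.pdf s := by
        rw [F.pdf_eq_hazard_mul hs]
        ring
      simp only [hG, hK, density, indicator_of_mem hs]
      rcases lt_or_gt_of_ne hsr with h | h
      · rw [indicator_of_notMem (notMem_Ioi.2 h.le)]
        have h1 : F.virtualValuation 1 s ≤ 0 := by
          have := mul_le_mul_of_nonneg_right (hlow s hs h) hS.le
          by_contra! hpos
          have := mul_pos hpos hp
          linarith
        rw [posVirtual, max_eq_right h1]
        ring
      · rw [indicator_of_mem (mem_Ioi.2 h)]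
        have h1 : 0 ≤ F.virtualValuation 1 s := by
          have := mul_le_mul_of_nonneg_right (hhigh s hs h).le hS.le
          by_contra! hneg
          have := mul_neg_of_neg_of_pos hneg hp
          linarith
        rw [posVirtual, max_eq_left h1]
        simp only [indicator_of_mem hs]
        linear_combination F.cdf s ^ (n - 1) * hval
    · have hd : F.density s = 0 := indicator_of_notMem hs _
      -- Off the support F is 0 or 1. Where F = 0 this needs n - 1 ≥ 1.
      have hK0 : K s = 0 := by
        simp only [hK, hd]
        have h0 : (0 : ℝ) ^ (n - 1) = 0 := zero_pow (by omega)
        rcases F.cdf_eq_zero_or_one hs with h | h <;> simp [h, h0]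
      simp [hG, hd, indicator, hK0]
  have hGK_ae : G =ᵐ[volume] (Ioi r).indicator K := by
    filter_upwards [Measure.ae_ne volume r] with s hs using hGK s hs
  have hcast : ∀ s, (ENNReal.ofReal (F.density s)).toReal = F.density s := fun s =>
    ENNReal.toReal_ofReal (F.density_nonneg s)
  have hlaw : ∫ s, F.posVirtual s * F.cdf s ^ (n - 1) ∂F.law = ∫ s in Ioi r, K s := by
    rw [law_eq_withDensity, integral_withDensity_eq_integral_toReal_smul
      F.measurable_density.ennreal_ofReal (Eventually.of_forall fun _ => ENNReal.ofReal_lt_top)]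
    simp only [hcast, smul_eq_mul]
    rw [← integral_indicator measurableSet_Ioi]
    exact integral_congr_ae hGK_ae
  have hKint : IntegrableOn K (Ioi r) := by
    rw [← integrable_indicator_iff measurableSet_Ioi]
    refine Integrable.congr ?_ hGK_ae
    have h1 : Integrable (fun s => F.cdf s ^ (n - 1) * F.posVirtual s) F.law :=
      hF.integrable_posVirtual.bdd_mul (c := 1)
        (F.continuous_cdf.pow _).aestronglyMeasurable (Eventually.of_forall fun s => by
          rw [Real.norm_of_nonneg (pow_nonneg (F.cdf_nonneg s) _)]
          exact pow_le_one₀ (F.cdf_nonneg s) (F.cdf_le_one s))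
    rw [law_eq_withDensity, integrable_withDensity_iff_integrable_smul'
      F.measurable_density.ennreal_ofReal (Eventually.of_forall fun _ => ENNReal.ofReal_lt_top)]
      at h1
    refine h1.congr (Eventually.of_forall fun s => ?_)
    simp only [hcast, smul_eq_mul, hG]
    ring
  have hW := hF.integrableOn_twoTail hn
  have hWr : IntegrableOn (fun s => twoTail n (F.cdf s)) (Ioi r) :=
    hW.mono_set (Ioi_subset_Ioi hr)
  have hWc : Continuous fun s => twoTail n (F.cdf s) :=
    (continuous_twoTail n).comp F.continuous_cdf
  have hfin : ∀ T, r ≤ T → ∫ s in r..T, n * K s ≤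
      r * (1 - F.cdf r ^ n) + ∫ s in Ioi r, twoTail n (F.cdf s) := by
    intro T hT
    obtain ⟨C, hC, hderiv⟩ := hF.exists_countable_hasDerivAt
    have hKii : IntervalIntegrable (fun s => n * K s) volume r T :=
      ((intervalIntegrable_iff_integrableOn_Ioc_of_le hT).2
        (hKint.mono_set Ioc_subset_Ioi_self)).const_mul _
    have hWii : IntervalIntegrable (fun s => twoTail n (F.cdf s)) volume r T :=
      hWc.intervalIntegrable _ _
    -- (s(1 - F^n))' = `twoTail n (F s)` - nK(s). The boundary term at T is nonnegative and is
    -- dropped below.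
    have hftc := MeasureTheory.integral_eq_of_hasDerivAt_off_countable
      (fun s => s * (1 - F.cdf s ^ n)) (fun s => twoTail n (F.cdf s) - n * K s)
      (a := r) (b := T) hC
      (continuous_id.mul (continuous_const.sub (F.continuous_cdf.pow n))).continuousOn
      (fun s hs => by
        refine ((hasDerivAt_id s).mul (((hderiv s hs.2).pow n).const_sub 1)).congr_deriv ?_
        simp only [id, hK, twoTail, Pi.pow_apply]
        ring)
      (hWii.sub hKii)
    rw [intervalIntegral.integral_sub hWii hKii] at hftc
    have h1 : ∫ s in r..T, twoTail n (F.cdf s) ≤ ∫ s in Ioi r, twoTail n (F.cdf s) := by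
      rw [intervalIntegral.integral_of_le hT]
      exact setIntegral_mono_set hWr
        (Eventually.of_forall fun s => twoTail_nonneg hn (F.cdf_nonneg s) (F.cdf_le_one s))
        Ioc_subset_Ioi_self.eventuallyLE
    have h2 : 0 ≤ T * (1 - F.cdf T ^ n) := mul_nonneg (hr.trans hT)
      (sub_nonneg.2 (pow_le_one₀ (F.cdf_nonneg T) (F.cdf_le_one T)))
    linarith
  rw [hlaw, ← integral_const_mul]
  refine le_of_tendsto (intervalIntegral_tendsto_integral_Ioi r (hKint.const_mul (n : ℝ))
    tendsto_id) ?_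
  filter_upwards [eventually_ge_atTop r] with T hT using hfin T hT

lemma one_lt_harmonic {n : ℕ} (hn : 2 ≤ n) : (1 : ℝ) < harmonic n := by
  obtain ⟨m, rfl⟩ := Nat.exists_eq_add_of_le' hn
  have h : (1 : ℚ) < harmonic (m + 2) := by
    rw [harmonic, Finset.sum_range_succ', Finset.sum_range_succ']
    have : (0 : ℚ) ≤ ∑ k ∈ Finset.range m, (((k + 1 + 1 + 1 : ℕ)) : ℚ)⁻¹ :=
      Finset.sum_nonneg fun k _ => by positivity
    norm_num at this ⊢
    linarith
  exact_mod_cast h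

/-- Revenue of truthful mechanisms: at most the `1 - exp (1 - H_n)` quantile, up to a correction
at the monopoly reserve. -/
lemma IsMHR.exists_revenue_bound (hF : F.IsMHR) {n : ℕ} (hn : 2 ≤ n) :
    ∃ x r : ℝ, 0 < x ∧ F.cdf x = 1 - Real.exp (-((harmonic n : ℝ) - 1)) ∧
      0 ≤ r ∧ F.cdf r ≤ 1 - Real.exp (-1) ∧
      ∀ R ∈ F.mechanismRevenues n, R ≤ x + r * ((1 - F.cdf r) * F.cdf r ^ (n - 1)) := by
  have ht := sub_pos.2 (one_lt_harmonic hn)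
  obtain ⟨x, hx, hFx⟩ := F.exists_cdf_eq (u := 1 - Real.exp (-((harmonic n : ℝ) - 1)))
    (sub_pos.2 (Real.exp_lt_one_iff.2 (neg_lt_zero.2 ht))) (sub_lt_self _ (Real.exp_pos _))
  obtain ⟨r, hr, hq, hlow, hhigh⟩ := hF.exists_reserve
  refine ⟨x, r, F.pos_of_mem_interior hx, hFx, hr, hq, ?_⟩
  rintro R ⟨M, hE, hT, hR, rfl⟩
  have h1 := Mechanism.expectedRevenue_le (by omega) hF hE hT hR
  have h2 := hF.integral_posVirtual_le hn hr hlow hhigh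
  have h3 := hF.integral_twoTail_le hn hx hFx
  have h4 := hF.le_integral_twoTail hn hr (hq.trans_lt (sub_lt_self _ (Real.exp_pos _)))
  have hW := hF.integrableOn_twoTail hn
  rw [intervalIntegral.integral_of_le hr] at h4
  rw [← Ioc_union_Ioi_eq_Ioi hr, setIntegral_union (Ioc_disjoint_Ioi le_rfl) measurableSet_Ioi
    (hW.mono_set Ioc_subset_Ioi_self) (hW.mono_set (Ioi_subset_Ioi hr))] at h3
  -- With q = F(r), the correction is r(1 - q^n) - r(1 - q^(n-1)) = r(1 - q)q^(n-1).
  have h5 : F.cdf r ^ n = F.cdf r ^ (n - 1) * F.cdf r := by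
    rw [← pow_succ, Nat.sub_add_cancel (by omega)]
  rw [h5] at h2
  linarith

end ValuationDistribution

/-! ### Posted prices as mechanisms -/

/-- Offer the price `p` to the bidders one after the other. -/
def postedPrice (n : ℕ) (p : ℝ) : Mechanism n where
  alloc b i := {b : Fin n → ℝ | p < b i ∧ ∀ j < i, b j ≤ p}.indicator 1 b
  pay b i := p * {b : Fin n → ℝ | p < b i ∧ ∀ j < i, b j ≤ p}.indicator 1 b
  measurable_alloc := measurable_pi_lambda _ fun i =>
    measurable_one.indicator (by measurability)
  measurable_pay := measurable_pi_lambda _ fun i =>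
    (measurable_one.indicator (by measurability)).const_mul p
  alloc_nonneg b i := indicator_nonneg (fun _ _ => zero_le_one) b
  sum_alloc_le_one b := by
    classical
    simp only [indicator_apply, Pi.one_apply, Finset.sum_boole, mem_ofPred_eq]
    refine Nat.cast_le_one.2 (Finset.card_le_one.2 fun i hi j hj => ?_)
    simp only [Finset.mem_filter, Finset.mem_univ, true_and] at hi hj
    rcases lt_trichotomy i j with h | h | h
    · exact absurd (hj.2 i h) hi.1.not_ge
    · exact h
    · exact absurd (hi.2 j h) hj.1.not_ge

namespace postedPrice

open ValuationDistribution

variable {n : ℕ} {p : ℝ} {F : ValuationDistribution}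

lemma pay_eq (b : Fin n → ℝ) (i : Fin n) :
    (postedPrice n p).pay b i = p * (postedPrice n p).alloc b i := rfl

lemma alloc_update (w : Fin n → ℝ) (i : Fin n) (r : ℝ) :
    (postedPrice n p).alloc (Function.update w i r) i =
      (Ioi p).indicator 1 r * {w : Fin n → ℝ | ∀ j < i, w j ≤ p}.indicator 1 w := by
  classical
  have h : (∀ j < i, Function.update w i r j ≤ p) ↔ ∀ j < i, w j ≤ p :=
    forall₂_congr fun j hj => by rw [Function.update_of_ne hj.ne]
  simp only [postedPrice, indicator_apply, Function.update_self, mem_ofPred_eq, h, mem_Ioi,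
    Pi.one_apply, ite_and, ite_mul, one_mul, zero_mul]

/-- Unless every bid is at most p, exactly one bidder wins: the first whose bid exceeds p. -/
lemma sum_alloc (b : Fin n → ℝ) :
    ∑ i, (postedPrice n p).alloc b i = 1 - (univ.pi fun _ : Fin n => Iic p).indicator 1 b := by
  classical
  simp only [postedPrice, indicator_apply, mem_ofPred_eq, Pi.one_apply]
  by_cases h : b ∈ univ.pi fun _ : Fin n => Iic p
  · rw [if_pos h, sub_self]
    refine Finset.sum_eq_zero fun i _ => if_neg fun hi => ?_
    exact hi.1.not_ge (h i (mem_univ i))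
  · rw [if_neg h, sub_zero]
    have hne : ∃ i, p < b i := by
      by_contra! hle
      exact h fun i _ => hle i
    obtain ⟨i, hi, hmin⟩ := WellFounded.has_min (wellFounded_lt (α := Fin n)) {i | p < b i} hne
    rw [Finset.sum_eq_single i, if_pos ⟨hi, fun j hj => not_lt.1 fun h => hmin j h hj⟩]
    · intro j _ hji
      refine if_neg fun hj => ?_
      rcases lt_or_gt_of_ne hji with h | h
      · exact hmin j hj.1 h
      · exact (hj.2 i h).not_gt hi
    · exact fun h => absurd (Finset.mem_univ i) h

lemma hasExpectedPayments : (postedPrice n p).HasExpectedPayments F := fun i =>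
  ⟨((postedPrice n p).integrable_of_alloc _ measurable_id i).const_mul p, fun r _ =>
    ((postedPrice n p).integrable_of_alloc _ (Mechanism.measurable_update_report i r) i).const_mul
      p⟩

lemma interimUtility_eq (i : Fin n) (v r : ℝ) :
    (postedPrice n p).interimUtility F i v r = (v - p) * (Ioi p).indicator 1 r *
      ∫ w, {w : Fin n → ℝ | ∀ j < i, w j ≤ p}.indicator 1 w ∂F.profileLaw n := by
  rw [← integral_const_mul]
  refine integral_congr_ae (Eventually.of_forall fun w => ?_)
  simp only [pay_eq, alloc_update]
  ring

lemma integral_indicator_nonneg (i : Fin n) :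
    0 ≤ ∫ w, {w : Fin n → ℝ | ∀ j < i, w j ≤ p}.indicator (1 : (Fin n → ℝ) → ℝ) w
      ∂F.profileLaw n :=
  integral_nonneg fun w => indicator_nonneg (fun _ _ => zero_le_one) w

lemma isTruthful : (postedPrice n p).IsTruthful F := by
  intro i v _ r _
  rw [interimUtility_eq, interimUtility_eq]
  refine mul_le_mul_of_nonneg_right ?_ (integral_indicator_nonneg i)
  by_cases hv : p < v <;> by_cases hr : p < r <;> simp [indicator, hv, hr] <;> linarith

lemma isIndividuallyRational : (postedPrice n p).IsIndividuallyRational F := by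
  intro i v _
  rw [interimUtility_eq]
  refine mul_nonneg ?_ (integral_indicator_nonneg i)
  by_cases hv : p < v <;> simp [indicator, hv]
  linarith

lemma expectedRevenue : (postedPrice n p).expectedRevenue F = F.pricingRevenueAt n p := by
  have hm : MeasurableSet (univ.pi fun _ : Fin n => Iic p) :=
    MeasurableSet.univ_pi fun _ => measurableSet_Iic
  have h1 : (F.profileLaw n).real (univ.pi fun _ : Fin n => Iic p) = F.cdf p ^ n := by
    rw [profileLaw, measureReal_def, Measure.pi_pi, ENNReal.toReal_prod]
    simp only [← measureReal_def, law_real_Iic, Finset.prod_const, Finset.card_univ,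
      Fintype.card_fin]
  rw [Mechanism.expectedRevenue, pricingRevenueAt]
  simp only [pay_eq, ← Finset.mul_sum, sum_alloc]
  have hint : Integrable ((univ.pi fun _ : Fin n => Iic p).indicator (1 : (Fin n → ℝ) → ℝ))
      (F.profileLaw n) := (integrable_const (1 : ℝ)).indicator hm
  rw [integral_const_mul, integral_sub (integrable_const _) hint, integral_indicator_one hm, h1]
  simp

end postedPrice

namespace ValuationDistribution

variable {F : ValuationDistribution}

lemma pricingRevenues_subset (F : ValuationDistribution) (n : ℕ) :
    F.pricingRevenues n ⊆ F.mechanismRevenues n := by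
  rintro _ ⟨p, -, rfl⟩
  exact ⟨postedPrice n p, postedPrice.hasExpectedPayments, postedPrice.isTruthful,
    postedPrice.isIndividuallyRational, postedPrice.expectedRevenue⟩

lemma IsMHR.bddAbove_mechanismRevenues (hF : F.IsMHR) {n : ℕ} (hn : 2 ≤ n) :
    BddAbove (F.mechanismRevenues n) := by
  obtain ⟨x, r, -, -, -, -, h⟩ := hF.exists_revenue_bound hn
  exact ⟨_, h⟩

lemma IsMHR.bddAbove_pricingRevenues (hF : F.IsMHR) {n : ℕ} (hn : 2 ≤ n) :
    BddAbove (F.pricingRevenues n) :=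
  (hF.bddAbove_mechanismRevenues hn).mono (F.pricingRevenues_subset n)

lemma nonempty_pricingRevenues (F : ValuationDistribution) (n : ℕ) :
    (F.pricingRevenues n).Nonempty :=
  (F.nonempty_interior.mono interior_subset).image _

lemma continuous_pricingRevenueAt (F : ValuationDistribution) (n : ℕ) :
    Continuous (F.pricingRevenueAt n) :=
  continuous_id.mul (continuous_const.sub (F.continuous_cdf.pow n))

lemma IsMHR.pricingRevenue_pos (hF : F.IsMHR) {n : ℕ} (hn : 2 ≤ n) :
    0 < F.pricingRevenue n := by
  obtain ⟨p, hp⟩ := F.nonempty_interior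
  refine lt_of_lt_of_le ?_ (le_csSup (hF.bddAbove_pricingRevenues hn)
    (mem_image_of_mem _ (interior_subset hp)))
  exact mul_pos (F.pos_of_mem_interior hp)
    (sub_pos.2 (pow_lt_one₀ (F.cdf_nonneg p) (F.cdf_lt_one hp) (by omega)))

/-- Prices outside the support cannot beat the prices in the support. -/
lemma IsMHR.pricingRevenueAt_le (hF : F.IsMHR) {n : ℕ} (hn : 2 ≤ n) (p : ℝ) :
    F.pricingRevenueAt n p ≤ F.pricingRevenue n := by
  have hI : ∀ s ∈ interior F.support, F.pricingRevenueAt n s ≤ F.pricingRevenue n := fun s hs =>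
    le_csSup (hF.bddAbove_pricingRevenues hn) (mem_image_of_mem _ (interior_subset hs))
  by_cases hp : p ∈ interior F.support
  · exact hI p hp
  obtain ⟨y, hy⟩ := F.nonempty_interior
  have hn0 : n ≠ 0 := by omega
  rcases lt_trichotomy p y with h | h | h
  -- Below the support a sale is certain, so raising the price to the left end point only helps;
  -- that end point is a limit of admissible prices.
  · have hle : p ≤ sInf (interior F.support) := le_csInf ⟨y, hy⟩ fun z hz => by
      by_contra! hzp
      exact hp (F.ordConnected_interior.out hz hy ⟨hzp.le, h.le⟩)
    have h1 : F.pricingRevenueAt n (sInf (interior F.support)) ≤ F.pricingRevenue n :=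
      closure_minimal hI (isClosed_le (F.continuous_pricingRevenueAt n) continuous_const)
        (csInf_mem_closure ⟨y, hy⟩ F.bddBelow_interior)
    rw [pricingRevenueAt, F.cdf_eq_zero_of_le_sInf le_rfl] at h1
    rw [pricingRevenueAt, F.cdf_eq_zero_of_le_sInf hle]
    simp only [zero_pow hn0, sub_zero, mul_one] at h1 ⊢
    exact hle.trans h1
  · exact absurd (h ▸ hy) hp
  · rw [pricingRevenueAt, F.cdf_eq_one_of_lt hp hy h, one_pow, sub_self, mul_zero]
    exact (hF.pricingRevenue_pos hn).le

lemma IsMHR.one_le_approxRatio (hF : F.IsMHR) {n : ℕ} (hn : 2 ≤ n) : 1 ≤ F.approxRatio n := by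
  rw [approxRatio, one_le_div (hF.pricingRevenue_pos hn)]
  exact csSup_le_csSup (hF.bddAbove_mechanismRevenues hn) (F.nonempty_pricingRevenues n)
    (F.pricingRevenues_subset n)

end ValuationDistribution

/-! ### The explicit bound on the ratio -/

/-- Used with A = e and B = e - 1 to compare the reserve correction with the revenue of the price r.
After both differences of powers are expanded as geometric sums, the inequality holds termwise by
(qA)^i ≤ B^i. -/
lemma one_sub_mul_pow_le {n : ℕ} {q A B : ℝ} (hq0 : 0 ≤ q) (hq1 : q ≤ 1) (hB : 0 ≤ B)
    (hAB : A - B = 1) (hqAB : q * A ≤ B) :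
    (1 - q) * q ^ (n - 1) * (A ^ n - B ^ n) ≤ B ^ (n - 1) * (1 - q ^ n) := by
  have hA : 0 ≤ A := by linarith
  have h1 := geom_sum₂_mul A B n
  have h2 := geom_sum₂_mul 1 q n
  rw [hAB, mul_one] at h1
  simp only [one_pow, one_mul] at h2
  rw [← h1, ← h2, mul_assoc, mul_comm (1 - q), ← mul_assoc (B ^ (n - 1)), Finset.mul_sum,
    Finset.mul_sum]
  refine mul_le_mul_of_nonneg_right (Finset.sum_le_sum fun i hi => ?_) (sub_nonneg.2 hq1)
  have hi : n - 1 = i + (n - 1 - i) := by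
    have := Finset.mem_range.1 hi
    omega
  generalize n - 1 - i = k at hi
  rw [hi, pow_add, pow_add]
  have h := mul_le_mul_of_nonneg_right (pow_le_pow_left₀ (mul_nonneg hq0 hA) hqAB i)
    (mul_nonneg (pow_nonneg hq0 k) (pow_nonneg hB k))
  rw [mul_pow] at h
  linarith

lemma exists_isGreatest_pricingAux (n : ℕ) :
    ∃ m : ℝ, IsGreatest (pricingAux n '' Icc (0 : ℝ) 1) m := by
  have hc : Continuous (pricingAux n) := by
    unfold pricingAux
    fun_prop
  exact (isCompact_Icc.image hc).exists_isGreatest ((nonempty_Icc.2 zero_le_one).image _)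

lemma pricingAux_one_pos {n : ℕ} (hn : 2 ≤ n) : 0 < pricingAux n 1 := by
  have ht := sub_pos.2 (ValuationDistribution.one_lt_harmonic hn)
  rw [pricingAux, one_mul, sub_pos]
  refine pow_lt_one₀ (sub_nonneg.2 (Real.exp_le_one_iff.2 ?_))
    (sub_lt_self _ (Real.exp_pos _)) (by omega)
  linarith

namespace ValuationDistribution

variable {F : ValuationDistribution}

lemma IsMHR.approxRatio_le (hF : F.IsMHR) {n : ℕ} (hn : 2 ≤ n) {m : ℝ}
    (hm : IsGreatest (pricingAux n '' Icc (0 : ℝ) 1) m) :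
    F.approxRatio n ≤ 1 / m +
      (Real.exp 1 - 1) ^ (n - 1) / (Real.exp 1 ^ n - (Real.exp 1 - 1) ^ n) := by
  obtain ⟨x, r, hx, hFx, hr, hq, hR⟩ := hF.exists_revenue_bound hn
  have hP := hF.pricingRevenue_pos hn
  have hmpos : 0 < m :=
    (pricingAux_one_pos hn).trans_le (hm.2 (mem_image_of_mem _ ⟨zero_le_one, le_rfl⟩))
  -- Post the price c·x for a maximizer c of g_n.
  have hxm : x * m ≤ F.pricingRevenue n := by
    obtain ⟨c, ⟨hc0, hc1⟩, rfl⟩ := hm.1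
    refine le_trans ?_ (hF.pricingRevenueAt_le hn (c * x))
    have hlt : F.cdf x < 1 := hFx ▸ sub_lt_self _ (Real.exp_pos _)
    have h1 := hF.survival_mul_ge hlt hc0 hc1
    rw [hFx, sub_sub_cancel, Real.log_exp, mul_neg, ← neg_mul] at h1
    have h2 : F.cdf (c * x) ≤ 1 - Real.exp (-c * ((harmonic n : ℝ) - 1)) := by linarith
    have h3 := pow_le_pow_left₀ (F.cdf_nonneg (c * x)) h2 n
    rw [pricingAux, pricingRevenueAt, ← mul_assoc, mul_comm x c]
    exact mul_le_mul_of_nonneg_left (by linarith) (mul_nonneg hc0 hx.le)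
  have hexp : 1 < Real.exp 1 := Real.one_lt_exp_iff.2 one_pos
  have hden : 0 < Real.exp 1 ^ n - (Real.exp 1 - 1) ^ n :=
    sub_pos.2 (pow_lt_pow_left₀ (by linarith) (by linarith) (by omega))
  have hqe : F.cdf r * Real.exp 1 ≤ Real.exp 1 - 1 := by
    have h := mul_le_mul_of_nonneg_right hq (Real.exp_pos 1).le
    rwa [sub_mul, one_mul, ← Real.exp_add, neg_add_cancel, Real.exp_zero] at h
  have h1 := one_sub_mul_pow_le (n := n) (F.cdf_nonneg r) (F.cdf_le_one r)
    (sub_nonneg.2 hexp.le) (sub_sub_cancel (Real.exp 1) 1) hqe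
  have h2 : r * ((1 - F.cdf r) * F.cdf r ^ (n - 1)) ≤
      (Real.exp 1 - 1) ^ (n - 1) / (Real.exp 1 ^ n - (Real.exp 1 - 1) ^ n) *
        F.pricingRevenue n := by
    have h3 := hF.pricingRevenueAt_le hn r
    rw [← le_div_iff₀ hden] at h1
    refine (mul_le_mul_of_nonneg_left h1 hr).trans ?_
    rw [pricingRevenueAt] at h3
    have h4 : 0 ≤ (Real.exp 1 - 1) ^ (n - 1) / (Real.exp 1 ^ n - (Real.exp 1 - 1) ^ n) :=
      div_nonneg (pow_nonneg (sub_nonneg.2 hexp.le) _) hden.le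
    have h5 := mul_le_mul_of_nonneg_left h3 h4
    refine le_trans (le_of_eq ?_) h5
    ring
  rw [approxRatio, div_le_iff₀ hP]
  refine csSup_le ((F.nonempty_pricingRevenues n).mono (F.pricingRevenues_subset n))
    fun R hRm => (hR R hRm).trans ?_
  rw [add_mul]
  refine add_le_add ?_ h2
  rw [div_mul_eq_mul_div, one_mul, le_div_iff₀ hmpos]
  exact hxm

end ValuationDistribution

/-! ### Asymptotics -/

lemma exp_correction_le {n : ℕ} (hn : 1 ≤ n) :
    (Real.exp 1 - 1) ^ (n - 1) / (Real.exp 1 ^ n - (Real.exp 1 - 1) ^ n) ≤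
      ((Real.exp 1 - 1) / Real.exp 1) ^ (n - 1) := by
  obtain ⟨m, rfl⟩ := Nat.exists_eq_add_of_le' hn
  have hexp : 1 < Real.exp 1 := Real.one_lt_exp_iff.2 one_pos
  have he := Real.exp_pos 1
  simp only [Nat.add_sub_cancel]
  rw [div_pow]
  refine div_le_div_of_nonneg_left (pow_nonneg (sub_nonneg.2 hexp.le) _) (pow_pos he m) ?_
  have h := mul_le_mul_of_nonneg_right (pow_le_pow_left₀ (sub_nonneg.2 hexp.le)
    (sub_le_self (Real.exp 1) zero_le_one) m) (sub_nonneg.2 hexp.le)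
  rw [pow_succ, pow_succ]
  linarith

lemma eventually_exp_correction_le :
    ∀ᶠ n : ℕ in atTop,
      (Real.exp 1 - 1) ^ (n - 1) / (Real.exp 1 ^ n - (Real.exp 1 - 1) ^ n) ≤ 1 / n := by
  have hexp : 1 < Real.exp 1 := Real.one_lt_exp_iff.2 one_pos
  have he := Real.exp_pos 1
  set q := (Real.exp 1 - 1) / Real.exp 1 with hq
  have hq0 : 0 < q := div_pos (sub_pos.2 hexp) he
  have hq1 : q < 1 := (div_lt_one he).2 (by linarith)
  -- Once n·q^n ≤ q, cancelling one factor q gives q^(n-1) ≤ 1/n.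
  have h := tendsto_self_mul_const_pow_of_lt_one hq0.le hq1
  filter_upwards [h.eventually_le_const hq0, eventually_ge_atTop 1] with n hn hn1
  refine (exp_correction_le hn1).trans ?_
  rw [← hq]
  obtain ⟨m, rfl⟩ := Nat.exists_eq_add_of_le' hn1
  have hmpos : (0 : ℝ) < ((m + 1 : ℕ) : ℝ) := by positivity
  rw [Nat.add_sub_cancel, le_div_iff₀ hmpos]
  rw [pow_succ, ← mul_assoc] at hn
  have := le_of_mul_le_mul_right (hn.trans_eq (one_mul q).symm) hq0
  linarith

/-- A near-optimal choice of the price level. -/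
lemma le_pricingAux {n : ℕ} (hn : 2 ≤ n) (hll : 1 ≤ Real.log (Real.log n)) {m : ℝ}
    (hm : IsGreatest (pricingAux n '' Icc (0 : ℝ) 1) m) :
    (1 - Real.log (Real.log n) / Real.log n) * (1 - 1 / n) ≤ m := by
  have hn0 : (0 : ℝ) < n := by positivity
  have hn1 : (1 : ℝ) ≤ n := by exact_mod_cast (by omega : 1 ≤ n)
  set L := Real.log n with hL
  set l := Real.log L with hl
  have hLpos : 0 < L := by
    refine (Real.log_nonneg hn1).lt_of_ne fun h => ?_
    rw [hl, hL, ← h, Real.log_zero] at hll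
    linarith
  have hLn : L ≤ n := (Real.log_le_sub_one_of_pos hn0).trans (by linarith)
  have hlL : l ≤ L := (Real.log_le_sub_one_of_pos hLpos).trans (by linarith)
  have ht := sub_pos.2 (ValuationDistribution.one_lt_harmonic hn)
  set t := (harmonic n : ℝ) - 1 with htdef
  have htL : t ≤ L := by
    have := harmonic_le_one_add_log n
    linarith
  have hLt : L - 1 ≤ t := by
    have h1 := log_add_one_le_harmonic n
    have h2 : L ≤ Real.log ((n + 1 : ℕ) : ℝ) := Real.log_le_log hn0 (by push_cast; linarith)
    linarith
  -- With c = (L - l)/t, exp(-ct) = L/n, so the failure probability (1 - L/n)^n is at most 1/n. The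
  -- bounds L - 1 ≤ t and l ≥ 1 give c ≤ 1.
  have hc0 : 0 ≤ (L - l) / t := div_nonneg (sub_nonneg.2 hlL) ht.le
  have hc1 : (L - l) / t ≤ 1 := (div_le_one ht).2 (by linarith)
  refine le_trans ?_ (hm.2 (mem_image_of_mem _ ⟨hc0, hc1⟩))
  have hexp : Real.exp (-((L - l) / t) * t) = L / n := by
    rw [neg_mul, div_mul_cancel₀ _ ht.ne', neg_sub, Real.exp_sub, hl, Real.exp_log hLpos, hL,
      Real.exp_log hn0]
  rw [pricingAux, ← htdef, hexp]
  have hpow : (1 - L / n) ^ n ≤ 1 / n := by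
    refine (Real.one_sub_div_pow_le_exp_neg hLn).trans_eq ?_
    rw [Real.exp_neg, hL, Real.exp_log hn0, one_div]
  have h1 : 1 - l / L ≤ (L - l) / t := by
    rw [one_sub_div hLpos.ne']
    exact div_le_div_of_nonneg_left (sub_nonneg.2 hlL) ht htL
  have h2 : 1 - 1 / (n : ℝ) ≤ 1 - (1 - L / n) ^ n := by linarith
  exact mul_le_mul h1 h2 (sub_nonneg.2 ((div_le_one hn0).2 hn1)) hc0

lemma eventually_approxRatio_sub_one_le :
    ∀ᶠ n : ℕ in atTop, ∀ F : ValuationDistribution, F.IsMHR →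
      |F.approxRatio n - 1| ≤ 5 * (Real.log (Real.log n) / Real.log n) := by
  have hlog : Tendsto (fun n : ℕ => Real.log n) atTop atTop :=
    Real.tendsto_log_atTop.comp tendsto_natCast_atTop_atTop
  have hsmall : Tendsto (fun n : ℕ => Real.log (Real.log n) / Real.log n) atTop (𝓝 0) :=
    (Real.isLittleO_log_id_atTop.tendsto_div_nhds_zero).comp hlog
  filter_upwards [eventually_ge_atTop 2, eventually_exp_correction_le,
    (Real.tendsto_log_atTop.comp hlog).eventually_ge_atTop 1, hlog.eventually_ge_atTop 1,
    hsmall.eventually_le_const (by norm_num : (0 : ℝ) < 1 / 4)] with n hn hcorr hll hL hε F hF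
  simp only [Function.comp_apply] at hll
  obtain ⟨m, hm⟩ := exists_isGreatest_pricingAux n
  have hle := hF.approxRatio_le hn hm
  have hge := hF.one_le_approxRatio hn
  have hmle := le_pricingAux hn hll hm
  set ε := Real.log (Real.log n) / Real.log n with hεdef
  have hn0 : (0 : ℝ) < n := by positivity
  have hnε : 1 / (n : ℝ) ≤ ε := by
    have hLn : Real.log n ≤ n := (Real.log_le_sub_one_of_pos hn0).trans (by linarith)
    exact div_le_div₀ (by linarith) hll (by linarith) hLn
  have hε0 : 0 ≤ ε := le_trans (by positivity) hnε
  have hm2 : 1 - 2 * ε ≤ m := by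
    refine le_trans ?_ hmle
    nlinarith [mul_nonneg (sub_nonneg.2 (hε.trans (by norm_num : (1 / 4 : ℝ) ≤ 1)))
      (sub_nonneg.2 hnε)]
  -- (1 - 2ε)(1 + 4ε) ≥ 1 exactly because 0 ≤ ε ≤ 1/4. The correction, at most 1/n ≤ ε, raises the
  -- constant to 5.
  have hinv : 1 / m ≤ 1 + 4 * ε := by
    rw [div_le_iff₀ (by linarith)]
    nlinarith
  rw [abs_of_nonneg (sub_nonneg.2 hge)]
  linarith

end

theorem mainTheorem1 :
    (∀ n : ℕ, 2 ≤ n → ∀ F : ValuationDistribution, F.IsMHR →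
      BddAbove (F.mechanismRevenues n) ∧
      BddAbove (F.pricingRevenues n) ∧
      0 < F.pricingRevenue n ∧
      ∃ m : ℝ, IsGreatest (pricingAux n '' Set.Icc (0 : ℝ) 1) m ∧
        F.approxRatio n ≤ 1 / m +
          (Real.exp 1 - 1) ^ (n - 1) / (Real.exp 1 ^ n - (Real.exp 1 - 1) ^ n)) ∧
    (∃ C : ℝ, ∀ᶠ n : ℕ in atTop, ∀ F : ValuationDistribution, F.IsMHR →
      |F.approxRatio n - 1| ≤ C * (Real.log (Real.log n) / Real.log n)) := by
  refine ⟨fun n hn F hF => ?_, 5, eventually_approxRatio_sub_one_le⟩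
  obtain ⟨m, hm⟩ := exists_isGreatest_pricingAux n
  exact ⟨hF.bddAbove_mechanismRevenues hn, hF.bddAbove_pricingRevenues hn,
    hF.pricingRevenue_pos hn, m, hm, hF.approxRatio_le hn hm⟩
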